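/- Let $K$ be a field of characteristic zero and let $\mathcal D$ be any set (finite or infinite). Let $\mathcal{B}r(\mathcal D)$ be the free brace algebra over $K$ generated by $\mathcal D$: the $K$-vector space with basis the planar rooted trees whose vertices are decorated by $\mathcal D$, with the multilinear operations $\langle -,\ldots,-;-\rangle$ such that, for all such trees $t_1,\ldots,t_n$, the element $\langle t_1,\ldots,t_{n-1};t_n\rangle$ is the sum of all graftings of the planar forest $t_1\cdots t_{n-1}$ over the tree $t_n$ (each $t_i$ being grafted on a vertex of $t_n$, at any place among its children, so that the left-to-right order of $t_1,\ldots,t_{n-1}$ is respected). Then $\mathcal{B}r(\mathcal D)$, with the product $x\circ y=\langle x;y\rangle$, which satisfies the left pre-Lie identity $$(x\circ y)\circ z-x\circ(y\circ z)=(y\circ x)\circ z-y\circ(x\circ z),$$ is a free pre-Lie algebra: there is a subset $S$ of $\mathcal{B}r(\mathcal D)$ such that the morphism of pre-Lie algebras $\mathcal{PL}(S)\to\mathcal{B}r(\mathcal D)$ extending the inclusion of $S$ is an isomorphism, where $\mathcal{PL}(S)$ denotes the free (left) pre-Lie algebra over $K$ generated by the set $S$. -/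

import Mathlib

/-! ## Brace algebras -/

/-- All ways of cutting a list `l` into two consecutive (possibly empty) intervals `(l₁, l₂)`. -/
def splits {α : Type*} : List α → List (List α × List α)
  | [] => [([], [])]
  | x :: l => ([], x :: l) :: (splits l).map fun p => (x :: p.1, p.2)

/-- For an operation `op`, thought of as `op [a₁, …, a_k] b = ⟨a₁, …, a_k; b⟩`, and two lists
`a = [a₁, …, a_m]`, `b = [b₁, …, b_n]`, the list of all words
`A₀, ⟨A₁; b₁⟩, A₂, ⟨A₃; b₂⟩, A₄, …, A_{2n-2}, ⟨A_{2n-1}; b_n⟩, A_{2n}`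
where `a = A₀ ⊔ ⋯ ⊔ A_{2n}` runs over the partitions of `a` into `2 n + 1` (possibly empty)
consecutive intervals. -/
def insertions {α : Type*} (op : List α → α → α) : List α → List α → List (List α)
  | a, [] => [a]
  | a, b :: bs =>
    (splits a).flatMap fun p => (splits p.2).flatMap fun q =>
      (insertions op q.2 bs).map fun L => p.1 ++ op q.1 b :: L

/-- A brace algebra: a `K`-module with multilinear operations
`brace K [a₁, …, a_n] c = ⟨a₁, …, a_n; c⟩` (`n ≥ 0`, with `⟨c⟩ = c`) such that
`⟨a₁, …, a_m; ⟨b₁, …, b_n; c⟩⟩` is the sum of all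
`⟨A₀, ⟨A₁; b₁⟩, A₂, …, ⟨A_{2n-1}; b_n⟩, A_{2n}; c⟩`. -/
class BraceAlgebra (K : Type*) (A : Type*) [CommRing K] [AddCommGroup A] [Module K A] where
  brace : List A → A → A
  brace_nil (c : A) : brace [] c = c
  brace_add_left (l r : List A) (x y c : A) :
    brace (l ++ (x + y) :: r) c = brace (l ++ x :: r) c + brace (l ++ y :: r) c
  brace_smul_left (l r : List A) (k : K) (x c : A) :
    brace (l ++ (k • x) :: r) c = k • brace (l ++ x :: r) c
  brace_add_right (l : List A) (c d : A) : brace l (c + d) = brace l c + brace l d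
  brace_smul_right (l : List A) (k : K) (c : A) : brace l (k • c) = k • brace l c
  brace_brace (a b : List A) (c : A) :
    brace a (brace b c) = ((insertions brace a b).map fun L => brace L c).sum

namespace BraceAlgebra

/-- The pre-Lie algebra underlying a brace algebra: the product is `x ∘ y = ⟨x; y⟩`. -/
abbrev toLeftPreLieRing (K : Type*) (A : Type*) [CommRing K] [AddCommGroup A] [Module K A]
    [BraceAlgebra K A] : LeftPreLieRing A where
  mul x y := brace K [x] y
  left_distrib x y z := brace_add_right [x] y z
  right_distrib x y z := brace_add_left [] [] x y z
  zero_mul x := by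
    have h := brace_smul_left (K := K) (A := A) [] [] 0 0 x
    rw [zero_smul, zero_smul] at h
    exact h
  mul_zero x := by
    have h := brace_smul_right (K := K) (A := A) [x] 0 0
    rw [zero_smul, zero_smul] at h
    exact h
  assoc_symm' x y z := by
    change brace K [brace K [x] y] z - brace K [x] (brace K [y] z)
      = brace K [brace K [y] x] z - brace K [y] (brace K [x] z)
    rw [brace_brace, brace_brace]
    simp [insertions, splits, brace_nil]
    abel

end BraceAlgebra

/-! ## Planar rooted trees and graftings -/

/-- Planar rooted trees with vertices decorated by `D`: `node d [t₁, …, t_n]` is the tree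
`B_d(t₁ … t_n)` obtained by grafting `t₁, …, t_n`, in this order from left to right, on a common
root decorated by `d`. -/
inductive PlanarTree (D : Type*) where
  | node : D → List (PlanarTree D) → PlanarTree D

namespace PlanarTree

variable {D : Type*}

mutual

/-- All graftings of the planar forest `a = [t₁, …, t_k]` over a planar tree: each `t_i` is grafted
on some vertex of the tree, at some place among the children of that vertex, in such a way that
`t₁, …, t_k` appear in this order from left to right. On the root, the grafting cuts `a` into
intervals which become new children of the root or are grafted over the old ones. The list carries
multiplicities. -/
def graft : List (PlanarTree D) → PlanarTree D → List (PlanarTree D)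
  | a, node d F => (graftForest a F).map (node d)
  termination_by structural _ t => t

/-- All words `A₀, s₁, A₂, s₂, …, s_n, A_{2n}` where `a = A₀ ⊔ A₁ ⊔ ⋯ ⊔ A_{2n}` as consecutive
intervals and `s_i` is a grafting of `A_{2i-1}` over the `i`-th tree of the forest. -/
def graftForest : List (PlanarTree D) → List (PlanarTree D) → List (List (PlanarTree D))
  | a, [] => [a]
  | a, f :: F =>
    (splits a).flatMap fun p => (splits p.2).flatMap fun q =>
      (graft q.1 f).flatMap fun s => (graftForest q.2 F).map fun G => p.1 ++ s :: G
  termination_by structural _ F => F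

end

end PlanarTree

section Sums

variable {α β γ M : Type*} [AddCommMonoid M]

/-- The sum of `φ x` for `x` in a list, with multiplicities. -/
def lsum (L : List α) (φ : α → M) : M := (L.map φ).sum

@[simp] theorem lsum_nil (φ : α → M) : lsum [] φ = 0 := rfl

@[simp] theorem lsum_cons (x : α) (L : List α) (φ : α → M) :
    lsum (x :: L) φ = φ x + lsum L φ := by simp [lsum]

@[simp] theorem lsum_append (L L' : List α) (φ : α → M) :
    lsum (L ++ L') φ = lsum L φ + lsum L' φ := by simp [lsum]

@[simp] theorem lsum_map (L : List α) (f : α → β) (φ : β → M) :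
    lsum (L.map f) φ = lsum L fun x => φ (f x) := by
  simp [lsum, Function.comp_def]

@[simp] theorem lsum_flatMap (L : List α) (f : α → List β) (φ : β → M) :
    lsum (L.flatMap f) φ = lsum L fun x => lsum (f x) φ := by
  induction L with
  | nil => rfl
  | cons x L ih => simp [ih]

@[simp] theorem lsum_zero (L : List α) : (lsum L fun _ => (0 : M)) = 0 := by simp [lsum]

theorem lsum_add (L : List α) (φ ψ : α → M) :
    (lsum L fun x => φ x + ψ x) = lsum L φ + lsum L ψ := by
  induction L with
  | nil => simp
  | cons x L ih => simp only [lsum_cons, ih]; abel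

theorem lsum_comm (L : List α) (L' : List β) (φ : α → β → M) :
    (lsum L fun x => lsum L' fun y => φ x y) = lsum L' fun y => lsum L fun x => φ x y := by
  induction L with
  | nil => simp
  | cons x L ih => simp only [lsum_cons, ih, lsum_add]

theorem map_lsum {N F : Type*} [AddCommMonoid N] [FunLike F M N] [AddMonoidHomClass F M N] (g : F)
    (L : List α) (φ : α → M) : g (lsum L φ) = lsum L fun x => g (φ x) := by
  induction L with
  | nil => simp
  | cons x L ih => simp only [lsum_cons, map_add, ih]

theorem lsum_splits_append (x y : List α) (a : α) (ψ : List α → List α → M) :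
    (lsum (splits (x ++ a :: y)) fun p => ψ p.1 p.2) =
      (lsum (splits x) fun p => ψ p.1 (p.2 ++ a :: y)) +
        lsum (splits y) fun p => ψ (x ++ a :: p.1) p.2 := by
  induction x generalizing ψ with
  | nil => simp [splits]
  | cons b x ih =>
    simp only [List.cons_append, splits, lsum_cons, lsum_map]
    rw [ih fun u v => ψ (b :: u) v, add_assoc]

theorem lsum_splits_assoc (a : List α) (ψ : List α → List α → List α → M) :
    (lsum (splits a) fun p => lsum (splits p.1) fun q => ψ q.1 q.2 p.2) =
      lsum (splits a) fun p => lsum (splits p.2) fun q => ψ p.1 q.1 q.2 := by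
  induction a generalizing ψ with
  | nil => simp [splits]
  | cons x a ih =>
    simp only [splits, lsum_cons, lsum_map, lsum_add, lsum_nil, add_zero]
    rw [ih fun u v w => ψ (x :: u) v w, add_assoc]

end Sums

namespace PlanarTree

variable {D : Type*} {M : Type*} [AddCommMonoid M]

theorem lsum_graft_node (a F : List (PlanarTree D)) (d : D) (φ : PlanarTree D → M) :
    lsum (graft a (node d F)) φ = lsum (graftForest a F) fun G => φ (node d G) := by
  simp [graft]

theorem lsum_graftForest_nil (a : List (PlanarTree D)) (φ : List (PlanarTree D) → M) :
    lsum (graftForest a []) φ = φ a := by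
  simp [graftForest]

theorem lsum_graftForest_cons (a F : List (PlanarTree D)) (f : PlanarTree D)
    (φ : List (PlanarTree D) → M) :
    lsum (graftForest a (f :: F)) φ =
      lsum (splits a) fun p => lsum (splits p.2) fun q => lsum (graft q.1 f) fun s =>
        lsum (graftForest q.2 F) fun G => φ (p.1 ++ s :: G) := by
  simp [graftForest]

theorem lsum_graftForest_append (a x y : List (PlanarTree D)) (t : PlanarTree D)
    (φ : List (PlanarTree D) → M) :
    lsum (graftForest a (x ++ t :: y)) φ =
      lsum (splits a) fun p => lsum (splits p.2) fun q => lsum (graftForest p.1 x) fun X =>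
        lsum (graft q.1 t) fun s => lsum (graftForest q.2 y) fun Y => φ (X ++ s :: Y) := by
  induction x generalizing a φ with
  | nil => simp only [List.nil_append, lsum_graftForest_cons, lsum_graftForest_nil]
  | cons f x ih =>
    simp only [List.cons_append, lsum_graftForest_cons, ih]
    -- both sides are sums over cuts of `a` into five intervals
    have key : ∀ ψ : List (PlanarTree D) → List (PlanarTree D) → List (PlanarTree D) →
        List (PlanarTree D) → List (PlanarTree D) → M,
        (lsum (splits a) fun p => lsum (splits p.2) fun q => lsum (splits q.2) fun r =>
          lsum (splits r.2) fun u => ψ p.1 q.1 r.1 u.1 u.2) =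
        (lsum (splits a) fun p => lsum (splits p.2) fun q => lsum (splits p.1) fun r =>
          lsum (splits r.2) fun u => ψ r.1 u.1 u.2 q.1 q.2) := by
      intro ψ
      have h1 : ∀ p : List (PlanarTree D) × List (PlanarTree D),
          (lsum (splits p.2) fun q => lsum (splits p.1) fun r =>
            lsum (splits r.2) fun u => ψ r.1 u.1 u.2 q.1 q.2) =
          lsum (splits p.1) fun r => lsum (splits r.2) fun u => lsum (splits p.2) fun q =>
            ψ r.1 u.1 u.2 q.1 q.2 := by
        intro p
        rw [lsum_comm]
        congr 1; funext r
        rw [lsum_comm]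
      simp only [h1]
      rw [lsum_splits_assoc a fun A B C =>
        lsum (splits B) fun u => lsum (splits C) fun q => ψ A u.1 u.2 q.1 q.2]
      congr 1; funext p
      rw [lsum_splits_assoc p.2 fun B C E => lsum (splits E) fun q => ψ p.1 B C q.1 q.2]
    have h2 : ∀ p q : List (PlanarTree D) × List (PlanarTree D),
        (lsum (graft q.1 f) fun s => lsum (splits q.2) fun p' => lsum (splits p'.2) fun q' =>
          lsum (graftForest p'.1 x) fun X => lsum (graft q'.1 t) fun s' =>
            lsum (graftForest q'.2 y) fun Y => φ (p.1 ++ s :: (X ++ s' :: Y))) =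
        lsum (splits q.2) fun p' => lsum (splits p'.2) fun q' => lsum (graft q.1 f) fun s =>
          lsum (graftForest p'.1 x) fun X => lsum (graft q'.1 t) fun s' =>
            lsum (graftForest q'.2 y) fun Y => φ (p.1 ++ s :: (X ++ s' :: Y)) := by
      intro p q
      rw [lsum_comm]
      congr 1; funext p'
      rw [lsum_comm]
    simp only [h2]
    rw [key fun A B C E G => lsum (graft B f) fun s =>
          lsum (graftForest C x) fun X => lsum (graft E t) fun s' =>
            lsum (graftForest G y) fun Y => φ (A ++ s :: (X ++ s' :: Y))]
    simp

theorem lsum_graftForest_splits (a b : List (PlanarTree D))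
    (ψ : List (PlanarTree D) → List (PlanarTree D) → M) :
    (lsum (graftForest a b) fun G => lsum (splits G) fun u => ψ u.1 u.2) =
      lsum (splits a) fun p => lsum (splits b) fun q =>
        lsum (graftForest p.1 q.1) fun X => lsum (graftForest p.2 q.2) fun Y => ψ X Y := by
  induction b generalizing a ψ with
  | nil => simp [splits, lsum_graftForest_nil]
  | cons f b ih =>
    simp only [lsum_graftForest_cons, lsum_splits_append, lsum_add, splits, lsum_cons, lsum_map,
      lsum_graftForest_nil]
    congr 1
    · rw [← lsum_splits_assoc a fun A B C => lsum (splits C) fun q => lsum (graft q.1 f) fun s =>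
        lsum (graftForest q.2 b) fun G => ψ A (B ++ s :: G)]
      have h : ∀ p : List (PlanarTree D) × List (PlanarTree D),
          (lsum (splits p.2) fun q => lsum (graft q.1 f) fun s =>
            lsum (graftForest q.2 b) fun G => lsum (splits p.1) fun v => ψ v.1 (v.2 ++ s :: G)) =
          lsum (splits p.1) fun v => lsum (splits p.2) fun q => lsum (graft q.1 f) fun s =>
            lsum (graftForest q.2 b) fun G => ψ v.1 (v.2 ++ s :: G) := by
        intro p
        simp only [lsum_comm (graftForest _ b) (splits p.1), lsum_comm (graft _ f) (splits p.1),
          lsum_comm (splits p.2) (splits p.1)]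
      simp only [h]
    · have h : ∀ p q : List (PlanarTree D) × List (PlanarTree D),
          (lsum (graft q.1 f) fun s => lsum (graftForest q.2 b) fun G =>
            lsum (splits G) fun u => ψ (p.1 ++ s :: u.1) u.2) =
          lsum (splits q.2) fun p' => lsum (splits b) fun q' => lsum (graft q.1 f) fun s =>
            lsum (graftForest p'.1 q'.1) fun X => lsum (graftForest p'.2 q'.2) fun Y =>
              ψ (p.1 ++ s :: X) Y := by
        intro p q
        have e : ∀ s : PlanarTree D, (lsum (graftForest q.2 b) fun G =>
            lsum (splits G) fun u => ψ (p.1 ++ s :: u.1) u.2) =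
          lsum (splits q.2) fun p' => lsum (splits b) fun q' =>
            lsum (graftForest p'.1 q'.1) fun X => lsum (graftForest p'.2 q'.2) fun Y =>
              ψ (p.1 ++ s :: X) Y :=
          fun s => ih _ fun u v => ψ (p.1 ++ s :: u) v
        simp only [e]
        rw [lsum_comm]
        congr 1; funext p'
        rw [lsum_comm]
      simp only [h]
      have h' : ∀ p : List (PlanarTree D) × List (PlanarTree D),
          (lsum (splits b) fun q' => lsum (splits p.1) fun r => lsum (splits r.2) fun u =>
            lsum (graft u.1 f) fun s => lsum (graftForest u.2 q'.1) fun X =>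
              lsum (graftForest p.2 q'.2) fun Y => ψ (r.1 ++ s :: X) Y) =
          lsum (splits p.1) fun r => lsum (splits r.2) fun u => lsum (splits b) fun q' =>
            lsum (graft u.1 f) fun s => lsum (graftForest u.2 q'.1) fun X =>
              lsum (graftForest p.2 q'.2) fun Y => ψ (r.1 ++ s :: X) Y := by
        intro p
        rw [lsum_comm]
        congr 1; funext r
        rw [lsum_comm]
      simp only [h']
      rw [lsum_splits_assoc a fun A B C => lsum (splits B) fun u => lsum (splits b) fun q' =>
        lsum (graft u.1 f) fun s => lsum (graftForest u.2 q'.1) fun X =>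
          lsum (graftForest C q'.2) fun Y => ψ (A ++ s :: X) Y]
      congr 1; funext p
      rw [lsum_splits_assoc p.2 fun A B C => lsum (splits b) fun q' =>
        lsum (graft A f) fun s => lsum (graftForest B q'.1) fun X =>
          lsum (graftForest C q'.2) fun Y => ψ (p.1 ++ s :: X) Y]

mutual

theorem graft_nil (t : PlanarTree D) : graft [] t = [t] := by
  match t with
  | node d F => simp [graft, graftForest_nil F]

theorem graftForest_nil (F : List (PlanarTree D)) : graftForest [] F = [F] := by
  match F with
  | [] => rfl
  | f :: F => simp [graftForest, splits, graft_nil f, graftForest_nil F]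

end

mutual

theorem lsum_graft_graft (a b : List (PlanarTree D)) (t : PlanarTree D) (φ : PlanarTree D → M) :
    (lsum (graft b t) fun s => lsum (graft a s) φ) =
      lsum (graftForest a b) fun H => lsum (graft H t) φ := by
  match t with
  | node d F =>
    simp only [lsum_graft_node]
    exact lsum_graftForest_graftForest a b F _

theorem lsum_graftForest_graftForest (a b F : List (PlanarTree D))
    (φ : List (PlanarTree D) → M) :
    (lsum (graftForest b F) fun G => lsum (graftForest a G) φ) =
      lsum (graftForest a b) fun H => lsum (graftForest H F) φ := by
  match F with
  | [] => simp only [lsum_graftForest_nil]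
  | f :: F =>
    have hr : (lsum (graftForest a b) fun H => lsum (graftForest H (f :: F)) φ) =
        lsum (splits a) fun p' => lsum (splits b) fun p =>
          lsum (graftForest p'.1 p.1) fun X =>
          lsum (splits p'.2) fun q' => lsum (splits p.2) fun q =>
          lsum (graftForest q'.1 q.1) fun H => lsum (graftForest q'.2 q.2) fun H' =>
          lsum (graft H f) fun s => lsum (graftForest H' F) fun Y => φ (X ++ s :: Y) := by
      simp only [lsum_graftForest_cons]
      rw [lsum_graftForest_splits a b fun X H => lsum (splits H) fun q => lsum (graft q.1 f) fun s =>
        lsum (graftForest q.2 F) fun Y => φ (X ++ s :: Y)]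
      congr 1; funext p'
      congr 1; funext p
      congr 1; funext X
      exact lsum_graftForest_splits p'.2 p.2 fun U V => lsum (graft U f) fun s =>
        lsum (graftForest V F) fun Y => φ (X ++ s :: Y)
    rw [hr]
    simp only [lsum_graftForest_cons]
    have hl : ∀ p q : List (PlanarTree D) × List (PlanarTree D),
        (lsum (graft q.1 f) fun s => lsum (graftForest q.2 F) fun G =>
          lsum (graftForest a (p.1 ++ s :: G)) φ) =
        lsum (splits a) fun p' => lsum (splits p'.2) fun q' =>
          lsum (graftForest p'.1 p.1) fun X =>
          lsum (graftForest q'.1 q.1) fun H => lsum (graftForest q'.2 q.2) fun H' =>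
          lsum (graft H f) fun s => lsum (graftForest H' F) fun Y => φ (X ++ s :: Y) := by
      intro p q
      simp only [lsum_graftForest_append a]
      simp only [lsum_comm (graftForest q.2 F) (splits _), lsum_comm (graft q.1 f) (splits _)]
      congr 1; funext p'
      congr 1; funext q'
      simp only [lsum_comm (graftForest q.2 F) (graftForest p'.1 _),
        lsum_comm (graft q.1 f) (graftForest p'.1 _)]
      congr 1; funext X
      have e1 : ∀ s : PlanarTree D, (lsum (graftForest q.2 F) fun G => lsum (graft q'.1 s) fun s' =>
            lsum (graftForest q'.2 G) fun Y => φ (X ++ s' :: Y)) =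
          lsum (graft q'.1 s) fun s' => lsum (graftForest q'.2 q.2) fun H' =>
            lsum (graftForest H' F) fun Y => φ (X ++ s' :: Y) := by
        intro s
        rw [lsum_comm]
        congr 1; funext s'
        exact lsum_graftForest_graftForest q'.2 q.2 F _
      simp only [e1]
      rw [lsum_graft_graft q'.1 q.1 f fun s' => lsum (graftForest q'.2 q.2) fun H' =>
            lsum (graftForest H' F) fun Y => φ (X ++ s' :: Y)]
      congr 1; funext H
      rw [lsum_comm]
    simp only [hl]
    have e2 : ∀ p : List (PlanarTree D) × List (PlanarTree D),
        (lsum (splits p.2) fun q => lsum (splits a) fun p' => lsum (splits p'.2) fun q' =>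
          lsum (graftForest p'.1 p.1) fun X =>
          lsum (graftForest q'.1 q.1) fun H => lsum (graftForest q'.2 q.2) fun H' =>
          lsum (graft H f) fun s => lsum (graftForest H' F) fun Y => φ (X ++ s :: Y)) =
        lsum (splits a) fun p' => lsum (graftForest p'.1 p.1) fun X =>
          lsum (splits p'.2) fun q' => lsum (splits p.2) fun q =>
          lsum (graftForest q'.1 q.1) fun H => lsum (graftForest q'.2 q.2) fun H' =>
          lsum (graft H f) fun s => lsum (graftForest H' F) fun Y => φ (X ++ s :: Y) := by
      intro p
      rw [lsum_comm]
      congr 1; funext p'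
      rw [lsum_comm, lsum_comm (graftForest p'.1 p.1)]
      congr 1; funext q'
      rw [lsum_comm]
    simp only [e2]
    rw [lsum_comm]

end

end PlanarTree

/-! ## The free brace algebra -/

/-- The `K`-module with basis the planar rooted trees decorated by `D`; with the brace operations
below it is the free brace algebra generated by `D`. -/
def Br (K : Type*) (D : Type*) [CommRing K] : Type _ := PlanarTree D →₀ K

namespace Br

noncomputable section

open PlanarTree

variable {K : Type*} [CommRing K] {D : Type*}

instance : AddCommGroup (Br K D) := inferInstanceAs (AddCommGroup (PlanarTree D →₀ K))

instance : Module K (Br K D) := inferInstanceAs (Module K (PlanarTree D →₀ K))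

variable (K) in
/-- The basis element given by a planar tree. -/
def of (t : PlanarTree D) : Br K D := Finsupp.single t 1

variable {M N : Type*} [AddCommGroup M] [Module K M] [AddCommGroup N] [Module K N]

/-- The linear extension of a map defined on planar trees. -/
def linExt (φ : PlanarTree D → M) : Br K D →ₗ[K] M := Finsupp.linearCombination K φ

/-- The multilinear extension of a map defined on lists of planar trees. -/
def multiExt : List (Br K D) → (List (PlanarTree D) → M) → M
  | [], φ => φ []
  | x :: l, φ => linExt (fun t => multiExt l fun F => φ (t :: F)) x

/-- The brace operations: on planar trees, `⟨t₁, …, t_n; t⟩` is the sum of all graftings of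
`t₁, …, t_n` over `t`, and this is extended multilinearly. -/
def brace (l : List (Br K D)) (c : Br K D) : Br K D :=
  multiExt l fun F => linExt (fun t => ((graft F t).map (of K)).sum) c

@[simp] theorem linExt_of (φ : PlanarTree D → M) (t : PlanarTree D) :
    linExt φ (of K t) = φ t := by
  unfold linExt of
  exact (Finsupp.linearCombination_single K 1 t).trans (one_smul K _)

theorem hom_ext {f g : Br K D →ₗ[K] M} (h : ∀ t, f (of K t) = g (of K t)) : f = g :=
  Finsupp.lhom_ext' fun t => LinearMap.ext_ring (h t)

theorem map_linExt (g : M →ₗ[K] N) (φ : PlanarTree D → M) (x : Br K D) :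
    g (linExt φ x) = linExt (fun t => g (φ t)) x := by
  have h : g ∘ₗ linExt φ = linExt fun t => g (φ t) := hom_ext fun t => by simp
  exact LinearMap.congr_fun h x

/-- `linExt φ x` as a linear function of `φ`. -/
def linExtₗ (x : Br K D) : (PlanarTree D → M) →ₗ[K] M where
  toFun φ := linExt φ x
  map_add' φ ψ := by
    have h : linExt (K := K) (φ + ψ) = linExt φ + linExt ψ := hom_ext fun t => by simp
    exact LinearMap.congr_fun h x
  map_smul' k φ := by
    have h : linExt (K := K) (k • φ) = k • linExt φ := hom_ext fun t => by simp
    exact LinearMap.congr_fun h x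

theorem linExt_lsum {α : Type*} (L : List α) (φ : PlanarTree D → α → M) (x : Br K D) :
    linExt (fun t => lsum L fun y => φ t y) x = lsum L fun y => linExt (fun t => φ t y) x := by
  have h := map_lsum (linExtₗ (M := M) x) L fun y t => φ t y
  have e : (lsum L fun y t => φ t y) = fun t => lsum L fun y => φ t y := by
    funext t
    exact map_lsum (LinearMap.proj (R := K) (φ := fun _ : PlanarTree D => M) t) L _
  rw [e] at h
  exact h

theorem map_multiExt (g : M →ₗ[K] N) (l : List (Br K D)) (φ : List (PlanarTree D) → M) :
    g (multiExt l φ) = multiExt l fun F => g (φ F) := by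
  induction l generalizing φ with
  | nil => rfl
  | cons x l ih => simp only [multiExt, map_linExt, ih]

/-- `multiExt l φ` as a linear function of `φ`. -/
def multiExtₗ : List (Br K D) → (List (PlanarTree D) → M) →ₗ[K] M
  | [] => LinearMap.proj []
  | x :: l => linExtₗ x ∘ₗ LinearMap.pi fun t =>
      multiExtₗ l ∘ₗ LinearMap.pi fun F => LinearMap.proj (t :: F)

theorem multiExtₗ_apply (l : List (Br K D)) (φ : List (PlanarTree D) → M) :
    multiExtₗ l φ = multiExt l φ := by
  induction l generalizing φ with
  | nil => rfl
  | cons x l ih =>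
    change linExt (fun t => multiExtₗ l fun F => φ (t :: F)) x = _
    simp only [ih, multiExt]

theorem multiExt_add (l : List (Br K D)) (φ ψ : List (PlanarTree D) → M) :
    (multiExt l fun F => φ F + ψ F) = multiExt l φ + multiExt l ψ := by
  simp only [← multiExtₗ_apply]
  exact map_add _ _ _

theorem multiExt_smul (l : List (Br K D)) (k : K) (φ : List (PlanarTree D) → M) :
    (multiExt l fun F => k • φ F) = k • multiExt l φ := by
  simp only [← multiExtₗ_apply]
  exact map_smul (multiExtₗ (M := M) l) k φ

theorem multiExt_lsum {α : Type*} (L : List α) (l : List (Br K D))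
    (φ : List (PlanarTree D) → α → M) :
    (multiExt l fun F => lsum L fun y => φ F y) = lsum L fun y => multiExt l fun F => φ F y := by
  induction l generalizing φ with
  | nil => rfl
  | cons x l ih => simp only [multiExt, ih, linExt_lsum]

theorem multiExt_linExt (l : List (Br K D)) (x : Br K D)
    (φ : List (PlanarTree D) → PlanarTree D → M) :
    (multiExt l fun F => linExt (fun t => φ F t) x) =
      linExt (fun t => multiExt l fun F => φ F t) x := by
  have h := map_multiExt (linExtₗ (M := M) x) l φ
  have e : multiExt l φ = fun t => multiExt l fun F => φ F t := by
    funext t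
    exact map_multiExt (LinearMap.proj (R := K) (φ := fun _ : PlanarTree D => M) t) l φ
  rw [e] at h
  exact h.symm

theorem multiExt_comm (l l' : List (Br K D))
    (φ : List (PlanarTree D) → List (PlanarTree D) → M) :
    (multiExt l fun F => multiExt l' fun G => φ F G) =
      multiExt l' fun G => multiExt l fun F => φ F G := by
  induction l generalizing φ with
  | nil => rfl
  | cons x l ih => simp only [multiExt, ih, multiExt_linExt]

theorem multiExt_append (l r : List (Br K D)) (φ : List (PlanarTree D) → M) :
    multiExt (l ++ r) φ = multiExt l fun F => multiExt r fun G => φ (F ++ G) := by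
  induction l generalizing φ with
  | nil => rfl
  | cons x l ih => simp only [List.cons_append, multiExt, ih]

theorem multiExt_of (F : List (PlanarTree D)) (φ : List (PlanarTree D) → M) :
    multiExt (F.map (of K)) φ = φ F := by
  induction F generalizing φ with
  | nil => rfl
  | cons t F ih => simp [multiExt, ih]

theorem multiExt_slot_add (l r : List (Br K D)) (x y : Br K D) (φ : List (PlanarTree D) → M) :
    multiExt (l ++ (x + y) :: r) φ = multiExt (l ++ x :: r) φ + multiExt (l ++ y :: r) φ := by
  simp only [multiExt_append, multiExt, map_add, multiExt_add]

theorem multiExt_slot_smul (l r : List (Br K D)) (k : K) (x : Br K D)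
    (φ : List (PlanarTree D) → M) :
    multiExt (l ++ (k • x) :: r) φ = k • multiExt (l ++ x :: r) φ := by
  simp only [multiExt_append, multiExt, map_smul, multiExt_smul]

theorem lsum_splits_multiExt (l : List (Br K D))
    (ψ : List (PlanarTree D) → List (PlanarTree D) → M) :
    (lsum (splits l) fun p => multiExt p.1 fun P => multiExt p.2 fun Q => ψ P Q) =
      multiExt l fun F => lsum (splits F) fun q => ψ q.1 q.2 := by
  induction l generalizing ψ with
  | nil => simp [splits, multiExt]
  | cons x l ih =>
    simp only [splits, lsum_cons, lsum_map, multiExt]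
    rw [← linExt_lsum]
    simp only [ih fun P Q => ψ (_ :: P) Q]
    refine (map_add (linExtₗ (M := M) x) _ _).symm.trans ?_
    change linExt _ x = linExt _ x
    congr 2
    funext t
    exact (multiExt_add l _ _).symm

theorem brace_eq (l : List (Br K D)) (c : Br K D) :
    brace l c = multiExt l fun F => linExt (fun t => lsum (graft F t) (of K)) c := rfl

/-- On planar trees, the brace is the sum of all graftings. -/
theorem brace_of (F : List (PlanarTree D)) (t : PlanarTree D) :
    brace (F.map (of K)) (of K t) = ((graft F t).map (of K)).sum := by
  rw [brace, multiExt_of, linExt_of]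

theorem linExt_brace (l : List (Br K D)) (c : Br K D) (φ : PlanarTree D → M) :
    linExt φ (brace l c) =
      multiExt l fun F => linExt (fun t => lsum (graft F t) φ) c := by
  simp only [brace_eq, map_multiExt, map_linExt, map_lsum, linExt_of]

theorem lsum_insertions (a b : List (Br K D)) (φ : List (PlanarTree D) → M) :
    (lsum (insertions brace a b) fun L => multiExt L φ) =
      multiExt a fun F => multiExt b fun G => lsum (graftForest F G) φ := by
  induction b generalizing a φ with
  | nil => simp [insertions, multiExt, lsum_graftForest_nil]
  | cons x b ih =>
    simp only [insertions, lsum_flatMap, lsum_map, multiExt_append, multiExt, linExt_brace]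
    have h1 : ∀ p q : List (Br K D) × List (Br K D),
        (lsum (insertions brace q.2 b) fun L => multiExt p.1 fun P => multiExt q.1 fun Q =>
          linExt (fun t => lsum (graft Q t) fun s => multiExt L fun F => φ (P ++ s :: F)) x) =
        multiExt p.1 fun P => multiExt q.1 fun Q => multiExt q.2 fun R =>
          linExt (fun t => multiExt b fun G => lsum (graft Q t) fun s =>
            lsum (graftForest R G) fun H => φ (P ++ s :: H)) x := by
      intro p q
      rw [← multiExt_lsum]
      congr 1; funext P
      rw [← multiExt_lsum]
      congr 1; funext Q
      rw [← linExt_lsum, multiExt_linExt]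
      congr 2; funext t
      rw [lsum_comm, multiExt_comm]
      simp only [multiExt_lsum]
      congr 1; funext s
      rw [ih q.2 fun F => φ (P ++ s :: F), multiExt_comm]
    simp only [h1]
    have h2 : ∀ p : List (Br K D) × List (Br K D),
        (lsum (splits p.2) fun q => multiExt p.1 fun P => multiExt q.1 fun Q =>
          multiExt q.2 fun R => linExt (fun t => multiExt b fun G => lsum (graft Q t) fun s =>
            lsum (graftForest R G) fun H => φ (P ++ s :: H)) x) =
        multiExt p.1 fun P => multiExt p.2 fun S => lsum (splits S) fun q =>
          linExt (fun t => multiExt b fun G => lsum (graft q.1 t) fun s =>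
            lsum (graftForest q.2 G) fun H => φ (P ++ s :: H)) x := by
      intro p
      rw [← multiExt_lsum]
      congr 1; funext P
      exact lsum_splits_multiExt p.2 fun Q R => linExt (fun t => multiExt b fun G =>
        lsum (graft Q t) fun s => lsum (graftForest R G) fun H => φ (P ++ s :: H)) x
    simp only [h2]
    rw [lsum_splits_multiExt a fun P S => lsum (splits S) fun q =>
          linExt (fun t => multiExt b fun G => lsum (graft q.1 t) fun s =>
            lsum (graftForest q.2 G) fun H => φ (P ++ s :: H)) x]
    congr 1; funext F
    simp only [← linExt_lsum, ← multiExt_lsum, lsum_graftForest_cons]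

instance : BraceAlgebra K (Br K D) where
  brace := brace
  brace_nil c := by
    have hg : ∀ t : PlanarTree D, lsum (graft [] t) (of K) = of K t := by
      intro t
      simp [graft_nil]
    have h : linExt (K := K) (fun t : PlanarTree D => lsum (graft [] t) (of K)) = LinearMap.id :=
      hom_ext fun t => by rw [linExt_of, hg, LinearMap.id_apply]
    exact LinearMap.congr_fun h c
  brace_add_left l r x y c := multiExt_slot_add l r x y _
  brace_smul_left l r k x c := multiExt_slot_smul l r k x _
  brace_add_right l c d := by simp only [brace, map_add, multiExt_add]
  brace_smul_right l k c := by simp only [brace, map_smul, multiExt_smul]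
  brace_brace a b c := by
    change _ = lsum (insertions brace a b) fun L => brace L c
    simp only [brace_eq _ c, lsum_insertions]
    rw [brace_eq]
    congr 1; funext F
    rw [← brace_eq, linExt_brace]
    congr 1; funext G
    rw [← linExt_lsum]
    congr 2; funext t
    exact lsum_graft_graft F G t _

theorem brace_def (l : List (Br K D)) (c : Br K D) : BraceAlgebra.brace K l c = brace l c := rfl

/-! ### The universal property -/

section Universal

variable {A : Type*} [AddCommGroup A] [Module K A]

theorem slot_lsum {ψ : List A → N}
    (hadd : ∀ l r x y, ψ (l ++ (x + y) :: r) = ψ (l ++ x :: r) + ψ (l ++ y :: r))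
    (hsmul : ∀ l r (k : K) x, ψ (l ++ (k • x) :: r) = k • ψ (l ++ x :: r))
    {α : Type*} (L : List α) (g : α → A) (l r : List A) :
    ψ (l ++ lsum L g :: r) = lsum L fun y => ψ (l ++ g y :: r) := by
  induction L with
  | nil =>
    have h := hsmul l r 0 0
    rw [zero_smul, zero_smul] at h
    exact h
  | cons x L ih => rw [lsum_cons, hadd, ih, lsum_cons]

theorem eq_multiExt {ψ : List A → N}
    (hadd : ∀ l r x y, ψ (l ++ (x + y) :: r) = ψ (l ++ x :: r) + ψ (l ++ y :: r))
    (hsmul : ∀ l r (k : K) x, ψ (l ++ (k • x) :: r) = k • ψ (l ++ x :: r))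
    (φ : Br K D →ₗ[K] A) (l : List (Br K D)) :
    ψ (l.map φ) = multiExt l fun F => ψ (F.map fun t => φ (of K t)) := by
  induction l generalizing ψ with
  | nil => rfl
  | cons x l ih =>
    let g : Br K D →ₗ[K] N :=
      { toFun := fun y => ψ (φ y :: l.map φ)
        map_add' := fun y z => by rw [map_add]; exact hadd [] _ _ _
        map_smul' := fun k y => by rw [map_smul]; exact hsmul [] _ _ _ }
    have h : g = linExt fun t => multiExt l fun F => ψ ((t :: F).map fun t => φ (of K t)) := by
      refine hom_ext fun t => ?_
      rw [linExt_of]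
      exact ih (ψ := fun L => ψ (φ (of K t) :: L)) (fun l r x y => hadd (_ :: l) r x y)
        (fun l r k x => hsmul (_ :: l) r k x)
    exact LinearMap.congr_fun h x

theorem splits_map {α β : Type*} (g : α → β) (l : List α) :
    splits (l.map g) = (splits l).map fun p => (p.1.map g, p.2.map g) := by
  induction l with
  | nil => rfl
  | cons x l ih => simp [splits, ih]

variable [BraceAlgebra K A]

variable (K) in
/-- The value of a planar tree in a brace algebra: `B_d(t₁ … t_n) ↦ ⟨t₁, …, t_n; f d⟩`. -/
def treeEval (f : D → A) : PlanarTree D → A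
  | node d F => BraceAlgebra.brace K (F.map (treeEval f)) (f d)

mutual

theorem treeEval_graft (f : D → A) (a : List (PlanarTree D)) (t : PlanarTree D) :
    lsum (graft a t) (treeEval K f) =
      BraceAlgebra.brace K (a.map (treeEval K f)) (treeEval K f t) := by
  match t with
  | node d F =>
    simp only [lsum_graft_node, treeEval, BraceAlgebra.brace_brace]
    exact treeEval_graftForest f a F (ψ := fun L => BraceAlgebra.brace K L (f d))
      (fun l r x y => BraceAlgebra.brace_add_left l r x y (f d))
      (fun l r k x => BraceAlgebra.brace_smul_left l r k x (f d))

theorem treeEval_graftForest (f : D → A) (a F : List (PlanarTree D)) {ψ : List A → A}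
    (hadd : ∀ l r x y, ψ (l ++ (x + y) :: r) = ψ (l ++ x :: r) + ψ (l ++ y :: r))
    (hsmul : ∀ l r (k : K) x, ψ (l ++ (k • x) :: r) = k • ψ (l ++ x :: r)) :
    (lsum (graftForest a F) fun G => ψ (G.map (treeEval K f))) =
      lsum (insertions (BraceAlgebra.brace K) (a.map (treeEval K f)) (F.map (treeEval K f))) ψ := by
  match F with
  | [] => simp [insertions, lsum_graftForest_nil]
  | t :: F =>
    simp only [lsum_graftForest_cons, insertions, List.map_cons, lsum_flatMap, lsum_map,
      splits_map]
    congr 1; funext p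
    congr 1; funext q
    rw [← treeEval_graft f q.1 t]
    simp only [slot_lsum hadd hsmul]
    rw [lsum_comm]
    conv_rhs => rw [lsum_comm]
    rw [lsum_comm]
    congr 1; funext s
    rw [← treeEval_graftForest f q.2 F
      (ψ := fun L => ψ (p.1.map (treeEval K f) ++ treeEval K f s :: L))]
    · simp
    · intro l r x y
      simpa using hadd (p.1.map (treeEval K f) ++ treeEval K f s :: l) r x y
    · intro l r k x
      simpa using hsmul (p.1.map (treeEval K f) ++ treeEval K f s :: l) r k x

end

theorem brace_forest (F : List (PlanarTree D)) (d : D) :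
    BraceAlgebra.brace K (F.map (of K)) (of K (node d [])) = of K (node d F) := by
  rw [brace_def, brace_of]
  simp [graft, graftForest]

/-- `Br K D` is the free brace algebra generated by `D`: every map from `D` to a brace algebra
extends uniquely to a morphism of brace algebras. -/
theorem existsUnique_lift (f : D → A) :
    ∃! φ : Br K D →ₗ[K] A,
      (∀ l c, φ (BraceAlgebra.brace K l c) = BraceAlgebra.brace K (l.map φ) (φ c)) ∧
        ∀ d, φ (of K (node d [])) = f d := by
  refine ⟨linExt (treeEval K f), ⟨fun l c => ?_, fun d => ?_⟩, ?_⟩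
  · rw [brace_def, linExt_brace]
    have h := eq_multiExt (ψ := fun L => BraceAlgebra.brace K L (linExt (treeEval K f) c))
      (fun l r x y => BraceAlgebra.brace_add_left l r x y _)
      (fun l r k x => BraceAlgebra.brace_smul_left l r k x _) (linExt (treeEval K f)) l
    refine Eq.trans ?_ h.symm
    congr 1; funext F
    simp only [linExt_of, treeEval_graft]
    let g : A →ₗ[K] A :=
      { toFun := BraceAlgebra.brace K (F.map (treeEval K f))
        map_add' := BraceAlgebra.brace_add_right _
        map_smul' := BraceAlgebra.brace_smul_right _ }
    exact (map_linExt g (treeEval K f) c).symm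
  · rw [linExt_of, treeEval]
    exact BraceAlgebra.brace_nil _
  · rintro φ ⟨hφ, hf⟩
    have key : ∀ t : PlanarTree D, φ (of K t) = treeEval K f t := by
      intro t
      induction t using PlanarTree.rec (motive_2 := fun F =>
        F.map (fun t => φ (of K t)) = F.map (treeEval K f)) with
      | node d F ih =>
        rw [← brace_forest, hφ, hf, treeEval, List.map_map, ← ih]
        rfl
      | nil => rfl
      | cons t F h1 h2 => simp only [List.map_cons, h1, h2]
    exact hom_ext fun t => by rw [key, linExt_of]

end Universal

/-- The pre-Lie algebra structure of `Br K D`: the product is `x ∘ y = ⟨x; y⟩`. -/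
instance : LeftPreLieRing (Br K D) := BraceAlgebra.toLeftPreLieRing K (Br K D)

theorem mul_def (x y : Br K D) : x * y = BraceAlgebra.brace K [x] y := rfl

instance : LeftPreLieAlgebra K (Br K D) where
  smul_assoc k x y := BraceAlgebra.brace_smul_left [] [] k x y
  smul_comm k x y := (BraceAlgebra.brace_smul_right [x] k y).symm

end

end Br

/-! ## Free pre-Lie algebras -/

namespace FreePreLie

/-- The congruence generated by the (left) pre-Lie identity on the free nonassociative algebra. -/
inductive Rel (K : Type*) (X : Type*) [CommRing K] :
    FreeNonUnitalNonAssocAlgebra K X → FreeNonUnitalNonAssocAlgebra K X → Prop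
  | preLie (a b c : FreeNonUnitalNonAssocAlgebra K X) :
      Rel K X (a * b * c - a * (b * c)) (b * a * c - b * (a * c))
  | smul (k : K) {a b : FreeNonUnitalNonAssocAlgebra K X} : Rel K X a b → Rel K X (k • a) (k • b)
  | add_right {a b : FreeNonUnitalNonAssocAlgebra K X} (c : FreeNonUnitalNonAssocAlgebra K X) :
      Rel K X a b → Rel K X (a + c) (b + c)
  | mul_left (a : FreeNonUnitalNonAssocAlgebra K X) {b c : FreeNonUnitalNonAssocAlgebra K X} :
      Rel K X b c → Rel K X (a * b) (a * c)
  | mul_right {a b : FreeNonUnitalNonAssocAlgebra K X} (c : FreeNonUnitalNonAssocAlgebra K X) :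
      Rel K X a b → Rel K X (a * c) (b * c)

end FreePreLie

/-- The free (left) pre-Lie algebra `PL(X)` generated by a set `X`: the quotient of the free
nonassociative algebra on `X` by the pre-Lie identity. -/
def FreePreLie (K : Type*) (X : Type*) [CommRing K] : Type _ := Quot (FreePreLie.Rel K X)

namespace FreePreLie

noncomputable section

variable {K : Type*} {X : Type*} [CommRing K]

theorem Rel.add_left (a : FreeNonUnitalNonAssocAlgebra K X)
    {b c : FreeNonUnitalNonAssocAlgebra K X} (h : Rel K X b c) : Rel K X (a + b) (a + c) := by
  rw [add_comm _ b, add_comm _ c]; exact h.add_right _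

theorem Rel.neg {a b : FreeNonUnitalNonAssocAlgebra K X} (h : Rel K X a b) :
    Rel K X (-a) (-b) := by
  simpa only [neg_one_smul] using h.smul (-1)

theorem Rel.sub_left (a : FreeNonUnitalNonAssocAlgebra K X)
    {b c : FreeNonUnitalNonAssocAlgebra K X} (h : Rel K X b c) : Rel K X (a - b) (a - c) := by
  simpa only [sub_eq_add_neg] using h.neg.add_left a

theorem Rel.sub_right {a b : FreeNonUnitalNonAssocAlgebra K X}
    (c : FreeNonUnitalNonAssocAlgebra K X) (h : Rel K X a b) : Rel K X (a - c) (b - c) := by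
  simpa only [sub_eq_add_neg] using h.add_right (-c)

instance : Zero (FreePreLie K X) where zero := Quot.mk _ 0

instance : Add (FreePreLie K X) where
  add := Quot.map₂ (· + ·) (fun _ _ _ => Rel.add_left _) fun _ _ _ => Rel.add_right _

instance : Neg (FreePreLie K X) where neg := Quot.map Neg.neg fun _ _ => Rel.neg

instance : Sub (FreePreLie K X) where
  sub := Quot.map₂ Sub.sub (fun _ _ _ => Rel.sub_left _) fun _ _ _ => Rel.sub_right _

instance : Mul (FreePreLie K X) where
  mul := Quot.map₂ (· * ·) (fun _ _ _ => Rel.mul_left _) fun _ _ _ => Rel.mul_right _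

instance : SMul K (FreePreLie K X) where smul k := Quot.map (k • ·) fun _ _ => Rel.smul k

instance : SMul ℕ (FreePreLie K X) where
  smul n := Quot.map (n • ·) fun a b h => by
    simpa only [Nat.cast_smul_eq_nsmul] using h.smul (n : K)

instance : SMul ℤ (FreePreLie K X) where
  smul n := Quot.map (n • ·) fun a b h => by
    simpa only [Int.cast_smul_eq_zsmul] using h.smul (n : K)

instance : AddCommGroup (FreePreLie K X) :=
  Function.Surjective.addCommGroup (Quot.mk (Rel K X)) Quot.mk_surjective rfl (fun _ _ => rfl)
    (fun _ => rfl) (fun _ _ => rfl) (fun _ _ => rfl) fun _ _ => rfl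

instance : LeftPreLieRing (FreePreLie K X) where
  left_distrib := by
    rintro ⟨a⟩ ⟨b⟩ ⟨c⟩
    exact congrArg (Quot.mk (Rel K X)) (mul_add a b c)
  right_distrib := by
    rintro ⟨a⟩ ⟨b⟩ ⟨c⟩
    exact congrArg (Quot.mk (Rel K X)) (add_mul a b c)
  zero_mul := by
    rintro ⟨a⟩
    exact congrArg (Quot.mk (Rel K X)) (zero_mul a)
  mul_zero := by
    rintro ⟨a⟩
    exact congrArg (Quot.mk (Rel K X)) (mul_zero a)
  assoc_symm' := by
    rintro ⟨a⟩ ⟨b⟩ ⟨c⟩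
    exact Quot.sound (Rel.preLie a b c)

instance : LeftPreLieAlgebra K (FreePreLie K X) where
  one_smul := by
    rintro ⟨a⟩
    exact congrArg (Quot.mk (Rel K X)) (one_smul K a)
  mul_smul := by
    rintro k l ⟨a⟩
    exact congrArg (Quot.mk (Rel K X)) (mul_smul k l a)
  smul_zero := by
    rintro k
    exact congrArg (Quot.mk (Rel K X)) (smul_zero k)
  smul_add := by
    rintro k ⟨a⟩ ⟨b⟩
    exact congrArg (Quot.mk (Rel K X)) (smul_add k a b)
  add_smul := by
    rintro k l ⟨a⟩
    exact congrArg (Quot.mk (Rel K X)) (add_smul k l a)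
  zero_smul := by
    rintro ⟨a⟩
    exact congrArg (Quot.mk (Rel K X)) (zero_smul K a)
  smul_assoc := by
    rintro k ⟨a⟩ ⟨b⟩
    exact congrArg (Quot.mk (Rel K X)) (smul_mul_assoc k a b)
  smul_comm := by
    rintro k ⟨a⟩ ⟨b⟩
    exact congrArg (Quot.mk (Rel K X)) (mul_smul_comm k a b).symm

variable (K) in
/-- The generator of `PL(X)` given by an element of `X`. -/
def of (x : X) : FreePreLie K X := Quot.mk _ (FreeNonUnitalNonAssocAlgebra.of K x)

variable {A : Type*} [LeftPreLieRing A] [LeftPreLieAlgebra K A]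

theorem lift_spec (f : X → A) (a b : FreeNonUnitalNonAssocAlgebra K X) (h : Rel K X a b) :
    FreeNonUnitalNonAssocAlgebra.lift K f a = FreeNonUnitalNonAssocAlgebra.lift K f b := by
  induction h with
  | preLie a b c =>
    simp only [map_sub, map_mul]
    exact LeftPreLieRing.assoc_symm _ _ _
  | smul k _ ih => simp only [map_smul, ih]
  | add_right c _ ih => simp only [map_add, ih]
  | mul_left a _ ih => simp only [map_mul, ih]
  | mul_right c _ ih => simp only [map_mul, ih]

variable (K) in
/-- The morphism of pre-Lie algebras `PL(X) → A` extending a map `f : X → A`. -/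
def lift (f : X → A) : FreePreLie K X →ₙₐ[K] A where
  toFun c := Quot.liftOn c (FreeNonUnitalNonAssocAlgebra.lift K f) (lift_spec f)
  map_smul' := by
    rintro k ⟨a⟩
    exact map_smul (FreeNonUnitalNonAssocAlgebra.lift K f) k a
  map_zero' := map_zero (FreeNonUnitalNonAssocAlgebra.lift K f)
  map_add' := by
    rintro ⟨a⟩ ⟨b⟩
    exact map_add (FreeNonUnitalNonAssocAlgebra.lift K f) a b
  map_mul' := by
    rintro ⟨a⟩ ⟨b⟩
    exact map_mul (FreeNonUnitalNonAssocAlgebra.lift K f) a b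

/-- The universal property of `PL(X)`. -/
theorem existsUnique_lift (f : X → A) :
    ∃! φ : FreePreLie K X →ₙₐ[K] A, ∀ x, φ (of K x) = f x := by
  refine ⟨lift K f, fun x => FreeNonUnitalNonAssocAlgebra.lift_of_apply K f x, fun φ hφ => ?_⟩
  let q : FreeNonUnitalNonAssocAlgebra K X →ₙₐ[K] FreePreLie K X :=
    { toFun := Quot.mk (Rel K X)
      map_smul' := fun _ _ => rfl
      map_zero' := rfl
      map_add' := fun _ _ => rfl
      map_mul' := fun _ _ => rfl }
  have h : φ.comp q = FreeNonUnitalNonAssocAlgebra.lift K f :=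
    (FreeNonUnitalNonAssocAlgebra.lift_unique K f _).mp (funext hφ)
  ext ⟨a⟩
  exact NonUnitalAlgHom.congr_fun h a

end

end FreePreLie

/-- A pre-Lie algebra `A` is free if it has a free generating set: a subset `S` of `A` such that
the morphism of pre-Lie algebras `PL(S) → A` extending the inclusion of `S` is an isomorphism. -/
def IsFreePreLie (K : Type*) (A : Type*) [CommRing K] [LeftPreLieRing A] [LeftPreLieAlgebra K A] :
    Prop :=
  ∃ S : Set A, Function.Bijective (FreePreLie.lift K (fun s : S => (s : A)))

-- Let `rootMul x y` be the sum of all graftings of `x` on the root of `y`. Unlike the pre-Lie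
-- product, the operators `rootMul x` commute with each other. Moreover `x * y - rootMul x y`
-- collects the graftings of `x` over a child of the root, which leave the arity of the root
-- unchanged, while `rootMul` raises it by one: for the filtration by arity, the leading term of `x
-- * y` is `rootMul x y`.
--
-- For a linear form `l`, the operator `rootDel l` deletes the first child of the root with
-- coefficient `l`. It is locally nilpotent and satisfies `rootDel l (rootMul x y) = rootMul x
-- (rootDel l y) + l x • y`. For independent `v i` and dual forms `l i`, these are Weyl algebra
-- relations, so in characteristic zero the `rootMul (v i)` form a regular sequence, and monomials
-- in them applied to elements independent modulo `rootIdeal` are independent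
-- (`linearIndependent_rootMul`).
--
-- The free generators are trees whose classes form a basis of the quotient by `rootIdeal`. They
-- generate (`mem_of_mul_mem`): by induction on the number of vertices and then on the arity,
-- replacing a root grafting by a pre-Lie product costs only trees with the same weight and smaller
-- arity. They are free: any free pre-Lie algebra is spanned by the values `t₁ ∘ (t₂ ∘ ⋯ (t_k ∘ x))`
-- of rooted trees, represented by sorted planar trees (`span_sorted_eq_top`), and the images of
-- these values are independent, since their leading terms are distinct monomials in the `rootMul`
-- of smaller such values (`linearIndepOn_combEval`). No dimension is counted, so `D` may be
-- infinite.

-- Regular sequences from Weyl algebra relations.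

section Monomials

variable {K M I J : Type*} [Field K] [AddCommGroup M] [Module K M]

/-- The sum of the ranges of the operators `A i` for `i ∈ s`. -/
def sumRange (A : I → Module.End K M) (s : Set I) : Submodule K M :=
  ⨆ i ∈ s, LinearMap.range (A i)

theorem apply_mem_sumRange (A : I → Module.End K M) {s : Set I} {i : I} (hi : i ∈ s) (x : M) :
    A i x ∈ sumRange A s :=
  (le_iSup₂_of_le (f := fun i (_ : i ∈ s) => LinearMap.range (A i)) i hi le_rfl) ⟨x, rfl⟩

theorem sumRange_le {A : I → Module.End K M} {s : Set I} {N : Submodule K M}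
    (h : ∀ i ∈ s, ∀ x, A i x ∈ N) : sumRange A s ≤ N := by
  refine iSup₂_le fun i hi => ?_
  rintro _ ⟨x, rfl⟩
  exact h i hi x

variable {A B : I → Module.End K M}

theorem apply_mem_sumRange_of_commute (hA : ∀ i j, Commute (A i) (A j)) {s : Set I} (i : I) {x : M}
    (hx : x ∈ sumRange A s) : A i x ∈ sumRange A s := by
  have h : sumRange A s ≤ (sumRange A s).comap (A i) := by
    refine sumRange_le fun j hj y => ?_
    have e : A i (A j y) = A j (A i y) := LinearMap.congr_fun (hA i j) y
    rw [Submodule.mem_comap, e]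
    exact apply_mem_sumRange A hj _
  exact h hx

/-- Since `i ∉ s`, the operator `B i` commutes with every `A j`, `j ∈ s`. -/
theorem derivation_mem_sumRange (hB : ∀ i j x, i ≠ j → B i (A j x) = A j (B i x)) {s : Set I}
    {i : I} (hi : i ∉ s) {x : M} (hx : x ∈ sumRange A s) : B i x ∈ sumRange A s := by
  have h : sumRange A s ≤ (sumRange A s).comap (B i) := by
    refine sumRange_le fun j hj y => ?_
    rw [Submodule.mem_comap, hB i j y fun e => hi (e ▸ hj)]
    exact apply_mem_sumRange A hj _
  exact h hx

/-- Leibniz rule for the derivation `B i`; the factor `r + 1` is what characteristic zero allows one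
to divide by. -/
theorem derivation_pow_apply {i : I} (hB' : ∀ x, B i (A i x) = A i (B i x) + x) (r : ℕ) (x : M) :
    (B i ^ (r + 1)) (A i x) = A i ((B i ^ (r + 1)) x) + ((r : K) + 1) • (B i ^ r) x := by
  induction r generalizing x with
  | zero => simp [hB']
  | succ r ih =>
    have e (n : ℕ) (y : M) : (B i ^ (n + 1)) y = (B i ^ n) (B i y) := by
      rw [pow_succ, Module.End.mul_apply]
    rw [e (r + 1), hB', map_add, ih, ← e r, ← e (r + 1)]
    push_cast
    module

/-- Operators which have a locally nilpotent derivation form a regular sequence. -/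
theorem mem_sumRange_of_apply_mem [CharZero K] (hA : ∀ i j, Commute (A i) (A j))
    (hB : ∀ i j x, i ≠ j → B i (A j x) = A j (B i x))
    (hB' : ∀ i x, B i (A i x) = A i (B i x) + x) (hnil : ∀ i x, ∃ r, (B i ^ r) x = 0)
    {s : Set I} {i : I} (hi : i ∉ s) {x : M} (hx : A i x ∈ sumRange A s) : x ∈ sumRange A s := by
  have hpow : ∀ (r : ℕ) {y : M}, y ∈ sumRange A s → (B i ^ r) y ∈ sumRange A s := by
    intro r
    induction r with
    | zero => exact fun hy => hy
    | succ r ih =>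
      intro y hy
      rw [pow_succ, Module.End.mul_apply]
      exact ih (derivation_mem_sumRange hB hi hy)
  -- Descent on `r`: applying `B i ^ (r + 1)` to `A i x` gives, modulo the sum of ranges, `(r + 1)`
  -- times `(B i ^ r) x`. Local nilpotence provides the starting exponent.
  have h : ∀ r : ℕ, (B i ^ r) x ∈ sumRange A s → x ∈ sumRange A s := by
    intro r
    induction r with
    | zero => exact fun hy => hy
    | succ r ih =>
      intro hr
      have e := hpow (r + 1) hx
      rw [derivation_pow_apply (hB' i),
        Submodule.add_mem_iff_right _ (apply_mem_sumRange_of_commute hA i hr)] at e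
      exact ih ((Submodule.smul_mem_iff _ (Nat.cast_add_one_ne_zero r)).mp e)
  obtain ⟨r, hr⟩ := hnil i x
  exact h r (hr ▸ Submodule.zero_mem _)

/-- Asking only that the value lie in the ranges of the operators outside `s`, instead of being
zero, lets the induction on `s` run: with no variable left, the hypothesis becomes a relation modulo
all ranges, which `hc` excludes. -/
theorem eq_zero_of_monomials_mem [CharZero K] [LeftCommutative fun i (x : M) => A i x]
    (hA : ∀ i j, Commute (A i) (A j))
    (hB : ∀ i j x, i ≠ j → B i (A j x) = A j (B i x))
    (hB' : ∀ i x, B i (A i x) = A i (B i x) + x) (hnil : ∀ i x, ∃ r, (B i ^ r) x = 0)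
    {c : J → M} (hc : LinearIndependent K fun j => (sumRange A Set.univ).mkQ (c j))
    (s : Finset I) (F : Multiset I × J →₀ K) (hs : ∀ p ∈ F.support, ∀ i ∈ p.1, i ∈ s)
    (hF : Finsupp.linearCombination K (fun p : Multiset I × J =>
      p.1.foldr (fun i x => A i x) (c p.2)) F ∈ sumRange A (↑s : Set I)ᶜ) : F = 0 := by
  classical
  set ev := Finsupp.linearCombination K (fun p : Multiset I × J =>
      p.1.foldr (fun i x => A i x) (c p.2)) with hev
  induction s using Finset.induction_on generalizing F with
  | empty =>
    have hz : ∀ p ∈ F.support, p.1 = 0 := fun p hp =>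
      Multiset.eq_zero_of_forall_notMem fun i hi => by simpa using hs p hp i hi
    have hinj : Function.Injective fun j : J => ((0 : Multiset I), j) := fun a b h => by
      simpa using h
    set G : J →₀ K := F.comapDomain _ hinj.injOn with hG
    have e : F = G.mapDomain fun j : J => ((0 : Multiset I), j) := by
      rw [hG, Finsupp.mapDomain_comapDomain _ hinj]
      intro p hp
      exact ⟨p.2, Prod.ext (hz p hp).symm rfl⟩
    rw [e, hev, Finsupp.linearCombination_mapDomain] at hF
    have h0 := linearIndependent_iff.mp hc G (by
      have h1 := (Submodule.Quotient.mk_eq_zero _).mpr (by simpa using hF)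
      rw [← Submodule.mkQ_apply, Finsupp.apply_linearCombination] at h1
      simpa [Function.comp_def] using h1)
    rw [e, h0, Finsupp.mapDomain_zero]
  | insert i s hi ih =>
    -- Inner induction on a strict bound `n` for the degree in the variable `i`. The combination is
    -- split as `F₀ + i · F₁` with `F₀` free of `i`.
    have key : ∀ (n : ℕ) (F : Multiset I × J →₀ K),
        (∀ p ∈ F.support, ∀ k ∈ p.1, k ∈ insert i s) → (∀ p ∈ F.support, p.1.count i < n) →
        ev F ∈ sumRange A (↑(insert i s) : Set I)ᶜ → F = 0 := by
      intro n
      induction n with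
      | zero =>
        intro F _ hn _
        exact Finsupp.support_eq_empty.mp
          (Finset.eq_empty_of_forall_notMem fun p hp => absurd (hn p hp) (Nat.not_lt_zero _))
      | succ n ihn =>
        intro F hs hn hF
        let sh : Multiset I × J → Multiset I × J := fun p => (i ::ₘ p.1, p.2)
        have hinj : Function.Injective sh := by
          rintro ⟨m, j⟩ ⟨m', j'⟩ h
          simpa [sh] using h
        let F₀ := F.filter fun p => i ∉ p.1
        let F₁ := F.comapDomain sh hinj.injOn
        have hdec : F = F₀ + F₁.mapDomain sh := by
          have e : F₁.mapDomain sh = F.filter fun p => i ∈ p.1 := by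
            ext p
            by_cases hp : i ∈ p.1
            · obtain ⟨m, hm⟩ := Multiset.exists_cons_of_mem hp
              have hp' : p = sh (m, p.2) := Prod.ext hm rfl
              rw [Finsupp.filter_apply_pos (fun p : Multiset I × J => i ∈ p.1) F hp, hp',
                Finsupp.mapDomain_apply hinj, Finsupp.comapDomain_apply]
            · rw [Finsupp.filter_apply_neg (fun p : Multiset I × J => i ∈ p.1) F hp,
                Finsupp.mapDomain_of_notMem_range]
              rintro ⟨q, rfl⟩
              exact hp (Multiset.mem_cons_self _ _)
          rw [e]
          rw [add_comm]
          exact (Finsupp.filter_add_filter_not F _).symm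
        have hev₁ : ev (F₁.mapDomain sh) = A i (ev F₁) := by
          rw [hev, Finsupp.linearCombination_mapDomain, Finsupp.apply_linearCombination]
          congr 2
          funext p
          simp [sh]
        have hle : sumRange A (↑(insert i s) : Set I)ᶜ ≤ sumRange A (↑s : Set I)ᶜ :=
          sumRange_le fun k hk x => apply_mem_sumRange A (s := (↑s : Set I)ᶜ)
            (fun h => hk (Finset.mem_insert_of_mem h)) x
        -- The range of `A i` is among those outside `s`, so the part `i · F₁` is negligible and the
        -- outer induction applies to `F₀`.
        have h₀ : F₀ = 0 := by
          refine ih F₀ (fun p hp k hk => ?_) ?_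
          · rw [Finsupp.support_filter, Finset.mem_filter] at hp
            exact (Finset.mem_insert.mp (hs p hp.1 k hk)).resolve_left fun e => hp.2 (e ▸ hk)
          · have := hle hF
            rw [hdec, map_add, hev₁, Submodule.add_mem_iff_left _
              (apply_mem_sumRange A (by simpa using hi) _)] at this
            exact this
        -- Now `A i (ev F₁)` lies in ranges that do not include that of `A i`; regularity cancels `A
        -- i`, and `F₁` has lower degree in `i`.
        have h₁ : F₁ = 0 := by
          refine ihn F₁ (fun p hp k hk => ?_) (fun p hp => ?_) ?_
          · rw [Finsupp.comapDomain_support, Finset.mem_preimage] at hp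
            exact hs _ hp k (Multiset.mem_cons_of_mem hk)
          · rw [Finsupp.comapDomain_support, Finset.mem_preimage] at hp
            have := hn _ hp
            simpa [sh] using this
          · rw [hdec, h₀, zero_add, hev₁] at hF
            exact mem_sumRange_of_apply_mem hA hB hB' hnil (by simp) hF
        rw [hdec, h₀, h₁, Finsupp.mapDomain_zero, add_zero]
    refine key (F.support.sup (fun p => p.1.count i) + 1) F hs (fun p hp => ?_) hF
    exact Nat.lt_succ_of_le (Finset.le_sup (f := fun p : Multiset I × J => p.1.count i) hp)

/-- Let `A i` be commuting operators with locally nilpotent `B i` such that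
`B i ∘ A j = A j ∘ B i + δ i j`. The monomials in the `A i` applied to elements independent modulo
the ranges of the `A i` are linearly independent. -/
theorem linearIndependent_monomials [CharZero K] [LeftCommutative fun i (x : M) => A i x]
    (hA : ∀ i j, Commute (A i) (A j))
    (hB : ∀ i j x, i ≠ j → B i (A j x) = A j (B i x))
    (hB' : ∀ i x, B i (A i x) = A i (B i x) + x) (hnil : ∀ i x, ∃ r, (B i ^ r) x = 0)
    {c : J → M} (hc : LinearIndependent K fun j => (sumRange A Set.univ).mkQ (c j)) :
    LinearIndependent K fun p : Multiset I × J => p.1.foldr (fun i x => A i x) (c p.2) := by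
  classical
  refine linearIndependent_iff.mpr fun F hF => ?_
  refine eq_zero_of_monomials_mem hA hB hB' hnil hc (F.support.biUnion fun p => p.1.toFinset) F
    (fun p hp i hi => Finset.mem_biUnion.mpr ⟨p, hp, Multiset.mem_toFinset.mpr hi⟩) ?_
  rw [hF]
  exact Submodule.zero_mem _

end Monomials

-- Sorted trees span: values of trees in a pre-Lie algebra.

namespace PlanarTree

variable {D : Type*}

/-- The number of vertices of a planar tree. -/
def weight : PlanarTree D → ℕ
  | node _ F => (F.map weight).sum + 1

/-- The number of vertices of a planar forest. -/
def forestWeight (F : List (PlanarTree D)) : ℕ := (F.map weight).sum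

theorem weight_node (d : D) (F : List (PlanarTree D)) :
    weight (node d F) = forestWeight F + 1 := by
  rw [weight, forestWeight]

@[simp] theorem forestWeight_nil : forestWeight ([] : List (PlanarTree D)) = 0 := rfl

@[simp] theorem forestWeight_cons (t : PlanarTree D) (F : List (PlanarTree D)) :
    forestWeight (t :: F) = weight t + forestWeight F := by
  simp [forestWeight]

theorem weight_le_forestWeight {t : PlanarTree D} {F : List (PlanarTree D)} (h : t ∈ F) :
    weight t ≤ forestWeight F :=
  List.single_le_sum (by simp) _ (List.mem_map_of_mem h)

theorem _root_.List.Perm.forestWeight_eq {F G : List (PlanarTree D)} (h : F.Perm G) :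
    forestWeight F = forestWeight G :=
  (h.map weight).sum_eq

/-- Planar trees such that the children of each vertex are sorted. They represent the
rooted trees. -/
inductive IsSorted [LinearOrder (PlanarTree D)] : PlanarTree D → Prop
  | node (d : D) (F : List (PlanarTree D)) :
    F.Pairwise (· ≤ ·) → (∀ t ∈ F, IsSorted t) → IsSorted (node d F)

section Comb

variable {K X A : Type*} [Field K] [LeftPreLieRing A] [LeftPreLieAlgebra K A]

/-- The value `t₁ ∘ (t₂ ∘ ⋯ (t_k ∘ f x))` of the tree `B_x(t₁ … t_k)`. -/
def combEval (f : X → A) : PlanarTree X → A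
  | node x F => (F.map (combEval f)).foldr (· * ·) (f x)

theorem combEval_node (f : X → A) (x : X) (F : List (PlanarTree X)) :
    combEval f (node x F) = (F.map (combEval f)).foldr (· * ·) (f x) := by
  rw [combEval]

theorem combEval_node_nil (f : X → A) (x : X) : combEval f (node x []) = f x := by
  rw [combEval_node]; rfl

theorem combEval_node_cons (f : X → A) (x : X) (t : PlanarTree X) (F : List (PlanarTree X)) :
    combEval f (node x (t :: F)) = combEval f t * combEval f (node x F) := by
  rw [combEval_node, combEval_node]; rfl

theorem map_combEval {B : Type*} [LeftPreLieRing B] [LeftPreLieAlgebra K B] (φ : A →ₙₐ[K] B)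
    (f : X → A) (t : PlanarTree X) : φ (combEval f t) = combEval (fun x => φ (f x)) t := by
  induction t using PlanarTree.rec (motive_2 := fun F =>
    ∀ x, φ (combEval f (node x F)) = combEval (fun x => φ (f x)) (node x F)) with
  | node x F ih => exact ih x
  | nil => simp only [combEval_node_nil]
  | cons t F h1 h2 => simp only [combEval_node_cons, map_mul, h1, h2]

variable [LinearOrder (PlanarTree X)]

variable (K) in
/-- The span of the values of the sorted trees with at most `n` vertices. -/
def sortedSpan (f : X → A) (n : ℕ) : Submodule K A :=
  Submodule.span K (combEval f '' {t | IsSorted t ∧ weight t ≤ n})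

variable (K) in
/-- The span of the values of trees with at most `n` vertices and fewer than `k` children of the
root, all sorted. -/
def combSpan (f : X → A) (k n : ℕ) : Submodule K A :=
  Submodule.span K {a | ∃ x F, (∀ t ∈ F, IsSorted t) ∧ F.length < k ∧ forestWeight F + 1 ≤ n ∧
    combEval f (node x F) = a}

variable {f : X → A}

theorem combEval_mem_sortedSpan {t : PlanarTree X} {n : ℕ} (h : IsSorted t) (hn : weight t ≤ n) :
    combEval f t ∈ sortedSpan K f n :=
  Submodule.subset_span ⟨t, ⟨h, hn⟩, rfl⟩

theorem combSpan_mono {k l m n : ℕ} (h : k ≤ l) (h' : m ≤ n) :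
    combSpan K f k m ≤ combSpan K f l n := by
  refine Submodule.span_mono ?_
  rintro a ⟨x, F, h1, h2, h3, h4⟩
  exact ⟨x, F, h1, by omega, by omega, h4⟩

/-- Multiplying on the left by the value of a tree adds it as a first child. In `combSpan` each
child is sorted, but the list of children may be in any order. -/
theorem mul_mem_combSpan {a b : A} {k m n : ℕ} (ha : a ∈ sortedSpan K f m)
    (hb : b ∈ combSpan K f k n) : a * b ∈ combSpan K f (k + 1) (m + n) := by
  refine Submodule.span_induction (p := fun a _ => a * b ∈ combSpan K f (k + 1) (m + n))
    ?_ ?_ ?_ ?_ ha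
  · rintro _ ⟨t, ⟨ht, htm⟩, rfl⟩
    refine Submodule.span_induction (p := fun b _ => combEval f t * b ∈ combSpan K f (k + 1) (m + n))
      ?_ ?_ ?_ ?_ hb
    · rintro _ ⟨x, F, h1, h2, h3, rfl⟩
      refine Submodule.subset_span ⟨x, t :: F, ?_, ?_, ?_, combEval_node_cons f x t F⟩
      · simpa using ⟨ht, h1⟩
      · simpa using h2
      · rw [forestWeight_cons]; omega
    · rw [mul_zero]; exact Submodule.zero_mem _
    · intro u v _ _ hu hv
      rw [mul_add]; exact Submodule.add_mem _ hu hv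
    · intro r u _ hu
      rw [mul_smul_comm]; exact Submodule.smul_mem _ _ hu
  · rw [zero_mul]; exact Submodule.zero_mem _
  · intro u v _ _ hu hv
    rw [add_mul]; exact Submodule.add_mem _ hu hv
  · intro r u _ hu
    rw [smul_mul_assoc]; exact Submodule.smul_mem _ _ hu

/-- By the pre-Lie identity, exchanging two adjacent children costs `u ∘ (t ∘ y) - t ∘ (u ∘ y) = (u
∘ t - t ∘ u) ∘ y`. Both `u ∘ t` and `t ∘ u` are values of trees, which `ih` rewrites with sorted
ones, so two children have been merged into one: the error has strictly fewer children. -/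
theorem combEval_sub_mem_of_perm {n : ℕ}
    (ih : ∀ t : PlanarTree X, weight t ≤ n → combEval f t ∈ sortedSpan K f (weight t))
    (x : X) {F G : List (PlanarTree X)} (h : F.Perm G) (hF : ∀ t ∈ F, IsSorted t)
    (hn : forestWeight F ≤ n) :
    combEval f (node x F) - combEval f (node x G) ∈
      combSpan K f F.length (forestWeight F + 1) := by
  induction h with
  | nil => rw [sub_self]; exact Submodule.zero_mem _
  | cons t h ih' =>
    rw [forestWeight_cons] at hn
    rw [combEval_node_cons, combEval_node_cons, ← mul_sub, forestWeight_cons, add_assoc]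
    exact mul_mem_combSpan (combEval_mem_sortedSpan (hF t (by simp)) le_rfl)
      (ih' (fun u hu => hF u (by simp [hu])) (by omega))
  | swap t u F =>
    have hmul : ∀ t u : PlanarTree X, weight t + weight u ≤ n →
        combEval f t * combEval f u ∈ sortedSpan K f (weight t + weight u) := by
      rintro t ⟨y, G⟩ h
      have e : weight (node y (t :: G)) = weight t + weight (node y G) := by
        simp only [weight_node, forestWeight_cons]; omega
      rw [← combEval_node_cons, ← e]
      exact ih _ (e ▸ h)
    simp only [forestWeight_cons] at hn
    simp only [combEval_node_cons, forestWeight_cons]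
    have e : combEval f u * (combEval f t * combEval f (node x F)) -
        combEval f t * (combEval f u * combEval f (node x F)) =
        (combEval f u * combEval f t - combEval f t * combEval f u) * combEval f (node x F) := by
      have := LeftPreLieRing.assoc_symm (combEval f t) (combEval f u) (combEval f (node x F))
      simp only [associator_apply] at this
      rw [sub_eq_sub_iff_add_eq_add] at this
      rw [sub_mul, sub_eq_sub_iff_add_eq_add, add_comm]
      exact this
    rw [e]
    have h := mul_mem_combSpan (K := K) (f := f) (k := F.length + 1) (n := forestWeight F + 1)
      (Submodule.sub_mem _ (hmul u t (by omega))
        (add_comm (weight t) (weight u) ▸ hmul t u (by omega)))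
      (Submodule.subset_span (s := {a | ∃ x F, (∀ t ∈ F, IsSorted t) ∧ _ ∧ _ ∧
        combEval f (node x F) = a}) ⟨x, F, fun v hv => hF v (by simp [hv]), Nat.lt_succ_self _, le_rfl, rfl⟩)
    simpa [add_assoc] using h
  | trans h₁ h₂ ih₁ ih₂ =>
    have h1 := ih₁ hF hn
    have h2 := ih₂ (fun t ht => hF t (h₁.mem_iff.mpr ht)) (h₁.forestWeight_eq ▸ hn)
    rw [← h₁.length_eq, ← h₁.forestWeight_eq] at h2
    simpa using Submodule.add_mem _ h1 h2

/-- Induction on the number of children: sort them, and the error has fewer children. The root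
accounts for the step from `n` to `n + 1`. -/
theorem combSpan_le_sortedSpan {n : ℕ}
    (ih : ∀ t : PlanarTree X, weight t ≤ n → combEval f t ∈ sortedSpan K f (weight t))
    (k : ℕ) : combSpan K f k (n + 1) ≤ sortedSpan K f (n + 1) := by
  induction k with
  | zero =>
    refine Submodule.span_le.mpr ?_
    rintro _ ⟨x, F, -, h, -⟩
    exact absurd h (Nat.not_lt_zero _)
  | succ k ihk =>
    refine Submodule.span_le.mpr ?_
    rintro _ ⟨x, F, h1, h2, h3, rfl⟩
    have hp := (List.perm_insertionSort (· ≤ ·) F).symm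
    have h := combEval_sub_mem_of_perm (K := K) ih x hp h1 (by omega)
    have hs : combEval f (node x (F.insertionSort (· ≤ ·))) ∈ sortedSpan K f (n + 1) := by
      refine combEval_mem_sortedSpan (.node _ _ ?_ fun t ht => h1 t (hp.mem_iff.mpr ht)) ?_
      · exact List.pairwise_insertionSort _ _
      · rw [weight_node, ← hp.forestWeight_eq]; exact h3
    have h' := ihk (combSpan_mono (Nat.le_of_lt_succ h2) h3 h)
    simpa using Submodule.add_mem _ h' hs

/-- In a pre-Lie algebra, the values of all trees are combinations of values of sorted trees. -/
theorem combEval_mem_sortedSpan_weight (t : PlanarTree X) :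
    combEval f t ∈ sortedSpan K f (weight t) := by
  induction hn : weight t using Nat.strong_induction_on generalizing t with
  | _ n ih =>
    subst hn
    obtain ⟨x, F⟩ := t
    have ih' : ∀ t : PlanarTree X, weight t ≤ forestWeight F →
        combEval f t ∈ sortedSpan K f (weight t) := fun t ht =>
      ih _ (by rw [weight_node]; omega) t rfl
    -- Each child weighs less than the whole tree, so its value can be replaced by values of sorted
    -- trees without changing the number of children.
    have h : ∀ G : List (PlanarTree X), forestWeight G ≤ forestWeight F →
        combEval f (node x G) ∈ combSpan K f (G.length + 1) (forestWeight G + 1) := by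
      intro G
      induction G with
      | nil =>
        exact fun _ => Submodule.subset_span ⟨x, [], by simp, by simp, by simp, rfl⟩
      | cons t G ihG =>
        intro hG
        rw [forestWeight_cons] at hG
        rw [combEval_node_cons, forestWeight_cons, add_assoc]
        exact mul_mem_combSpan (ih' t (by omega)) (ihG (by omega))
    rw [weight_node]
    exact combSpan_le_sortedSpan ih' _ (h F le_rfl)

end Comb

end PlanarTree

-- A criterion for injectivity on the free pre-Lie algebra.

namespace FreePreLie

open PlanarTree

variable {K X : Type*} [Field K] [LinearOrder (PlanarTree X)]

/-- The free pre-Lie algebra is spanned by the values of the sorted trees. -/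
theorem span_sorted_eq_top :
    Submodule.span K (combEval (of K (X := X)) '' {t | IsSorted t}) = ⊤ := by
  set N := Submodule.span K (combEval (of K (X := X)) '' {t | IsSorted t}) with hN
  have hall : ∀ t, combEval (of K (X := X)) t ∈ N := fun t =>
    Submodule.span_mono (Set.image_mono fun _ h => h.1) (combEval_mem_sortedSpan_weight (K := K) t)
  -- A product of two values of trees is again the value of a tree.
  have hmul : ∀ a ∈ N, ∀ b ∈ N, a * b ∈ N := by
    intro a ha b hb
    refine Submodule.span_induction (p := fun a _ => a * b ∈ N) ?_ ?_ ?_ ?_ ha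
    · rintro _ ⟨t, -, rfl⟩
      refine Submodule.span_induction (p := fun b _ => combEval (of K) t * b ∈ N) ?_ ?_ ?_ ?_ hb
      · rintro _ ⟨⟨x, F⟩, -, rfl⟩
        rw [← combEval_node_cons]
        exact hall _
      · rw [mul_zero]; exact Submodule.zero_mem _
      · intro u v _ _ hu hv
        rw [mul_add]; exact Submodule.add_mem _ hu hv
      · intro r u _ hu
        rw [mul_smul_comm]; exact Submodule.smul_mem _ _ hu
    · rw [zero_mul]; exact Submodule.zero_mem _
    · intro u v _ _ hu hv
      rw [add_mul]; exact Submodule.add_mem _ hu hv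
    · intro r u _ hu
      rw [smul_mul_assoc]; exact Submodule.smul_mem _ _ hu
  let S : NonUnitalSubalgebra K (FreePreLie K X) :=
    { N with mul_mem' := fun {a b} ha hb => hmul a ha b hb }
  let _ : LeftPreLieRing S :=
    { (inferInstance : NonUnitalNonAssocRing S) with
      assoc_symm' := fun x y z => Subtype.ext (LeftPreLieRing.assoc_symm' x.1 y.1 z.1) }
  let _ : LeftPreLieAlgebra K S :=
    { (inferInstance : Module K S), (inferInstance : IsScalarTower K S S),
      (inferInstance : SMulCommClass K S S) with }
  let φ : FreePreLie K X →ₙₐ[K] S :=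
    lift K fun x => ⟨of K x, by rw [← combEval_node_nil (of K) x]; exact hall _⟩
  let ι : S →ₙₐ[K] FreePreLie K X := NonUnitalSubalgebraClass.subtype S
  -- The span is a pre-Lie subalgebra containing the generators. By the universal property the
  -- identity factors through it, so it is everything.
  have h : ι.comp φ = NonUnitalAlgHom.id K (FreePreLie K X) :=
    (existsUnique_lift (K := K) (of K (X := X))).unique
      (fun x => congrArg Subtype.val (FreeNonUnitalNonAssocAlgebra.lift_of_apply K _ x))
      fun _ => rfl
  refine eq_top_iff.mpr fun p _ => ?_
  have e : ((φ p : S) : FreePreLie K X) = p := NonUnitalAlgHom.congr_fun h p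
  rw [← e]
  exact (φ p).2

/-- A map to a pre-Lie algebra such that the values of the sorted trees are independent extends to
an injective morphism. -/
theorem lift_injective_of_linearIndependent {A : Type*} [LeftPreLieRing A] [LeftPreLieAlgebra K A]
    (f : X → A) (h : LinearIndependent K fun t : {t : PlanarTree X // IsSorted t} =>
      combEval f t.1) : Function.Injective (lift K f) := by
  have hf : ∀ t, lift K f (combEval (of K) t) = combEval f t := fun t => by
    rw [map_combEval]
    congr 1
    funext x
    exact FreeNonUnitalNonAssocAlgebra.lift_of_apply K f x
  refine (injective_iff_map_eq_zero (lift K f)).mpr fun p hp => ?_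
  have hmem : p ∈ Submodule.span K (Set.range fun t : {t : PlanarTree X // IsSorted t} =>
      combEval (of K) t.1) := by
    have e : (Set.range fun t : {t : PlanarTree X // IsSorted t} => combEval (of K) t.1) =
        combEval (of K (X := X)) '' {t | IsSorted t} := by
      rw [Set.image_eq_range]; rfl
    rw [e, span_sorted_eq_top]
    trivial
  obtain ⟨F, rfl⟩ := (Finsupp.mem_span_range_iff_exists_finsupp).mp hmem
  have hF := linearIndependent_iff.mp h F (by
    rw [← hp, Finsupp.linearCombination_apply, Finsupp.sum, Finsupp.sum, map_sum]
    simp only [map_smul, hf])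
  rw [hF, Finsupp.sum_zero_index]

end FreePreLie

-- Grafting a single tree: on the root or over a child.

namespace PlanarTree

variable {D : Type*} {M : Type*} [AddCommMonoid M]

/-- The number of children of the root. -/
def arity : PlanarTree D → ℕ
  | node _ F => F.length

theorem weight_pos (t : PlanarTree D) : 0 < weight t := by
  obtain ⟨d, F⟩ := t
  rw [weight_node]
  exact Nat.succ_pos _

/-- All insertions of an element in a list. -/
def inserts {α : Type*} (x : α) : List α → List (List α)
  | [] => [[x]]
  | y :: F => (x :: y :: F) :: (inserts x F).map (y :: ·)

theorem perm_of_mem_inserts {α : Type*} {x : α} {F G : List α} (h : G ∈ inserts x F) :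
    G.Perm (x :: F) := by
  induction F generalizing G with
  | nil => simp [inserts] at h; simp [h]
  | cons y F ih =>
    rw [inserts, List.mem_cons, List.mem_map] at h
    obtain rfl | ⟨H, hH, rfl⟩ := h
    · exact List.Perm.refl _
    · exact ((ih hH).cons y).trans (List.Perm.swap x y F)

/-- Both sides run over all ways of placing `x` and `y` in `F`, in either relative order. This makes
root graftings commute. -/
theorem lsum_inserts_comm {α : Type*} (x y : α) (F : List α) (φ : List α → M) :
    (lsum (inserts y F) fun G => lsum (inserts x G) φ) =
      lsum (inserts x F) fun G => lsum (inserts y G) φ := by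
  induction F generalizing φ with
  | nil => simp [inserts, add_comm]
  | cons z F ih =>
    simp only [inserts, lsum_cons, lsum_map, lsum_add]
    rw [ih fun G => φ (z :: G)]
    abel

/-- All graftings of a tree over one of the trees of a forest. -/
def graftChildren (x : PlanarTree D) : List (PlanarTree D) → List (List (PlanarTree D))
  | [] => []
  | f :: F => (graft [x] f).map (· :: F) ++ (graftChildren x F).map (f :: ·)

/-- The grafted tree either becomes a new child of the root or goes over an old child; only the
first kind changes the arity. -/
theorem lsum_graftForest_singleton (x : PlanarTree D) (F : List (PlanarTree D))
    (φ : List (PlanarTree D) → M) :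
    lsum (graftForest [x] F) φ = lsum (inserts x F) φ + lsum (graftChildren x F) φ := by
  induction F generalizing φ with
  | nil => simp [lsum_graftForest_nil, inserts, graftChildren]
  | cons f F ih =>
    simp only [lsum_graftForest_cons, splits, inserts, graftChildren, lsum_cons, lsum_map,
      lsum_append, lsum_nil, List.map_cons, List.map_nil, graft_nil, graftForest_nil,
      List.nil_append, List.cons_append, ih]
    abel_nf

theorem length_of_mem_graftChildren {x : PlanarTree D} {F G : List (PlanarTree D)}
    (h : G ∈ graftChildren x F) : G.length = F.length := by
  induction F generalizing G with
  | nil => simp [graftChildren] at h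
  | cons f F ih =>
    rw [graftChildren, List.mem_append, List.mem_map, List.mem_map] at h
    obtain ⟨s, -, rfl⟩ | ⟨H, hH, rfl⟩ := h
    · rfl
    · simp [ih hH]

theorem mem_graftForest_singleton {x : PlanarTree D} {F G : List (PlanarTree D)}
    (h : G ∈ graftForest [x] F) : G ∈ inserts x F ∨ G ∈ graftChildren x F := by
  induction F generalizing G with
  | nil => simpa [graftForest, inserts, graftChildren] using h
  | cons f F ih =>
    simp [graftForest, splits, graft_nil, graftForest_nil] at h
    simp only [inserts, graftChildren, List.mem_cons, List.mem_append, List.mem_map]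
    obtain ⟨H, hH, rfl⟩ | ⟨s, hs, rfl⟩ | rfl := h
    · obtain h | h := ih hH
      · exact .inl (.inr ⟨H, h, rfl⟩)
      · exact .inr (.inr ⟨H, h, rfl⟩)
    · exact .inr (.inl ⟨s, hs, rfl⟩)
    · exact .inl (.inl rfl)

mutual

theorem weight_of_mem_graft {x s : PlanarTree D} (t : PlanarTree D) (h : s ∈ graft [x] t) :
    weight s = weight x + weight t := by
  match t with
  | node d F =>
    rw [graft, List.mem_map] at h
    obtain ⟨G, hG, rfl⟩ := h
    rw [weight_node, weight_node]
    obtain h | h := mem_graftForest_singleton hG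
    · rw [(perm_of_mem_inserts h).forestWeight_eq, forestWeight_cons, add_assoc]
    · rw [forestWeight_of_mem_graftChildren F h, add_assoc]

theorem forestWeight_of_mem_graftChildren {x : PlanarTree D} {G : List (PlanarTree D)}
    (F : List (PlanarTree D)) (h : G ∈ graftChildren x F) :
    forestWeight G = weight x + forestWeight F := by
  match F with
  | [] => simp [graftChildren] at h
  | f :: F =>
    rw [graftChildren, List.mem_append, List.mem_map, List.mem_map] at h
    obtain ⟨s, hs, rfl⟩ | ⟨H, hH, rfl⟩ := h
    · rw [forestWeight_cons, forestWeight_cons, weight_of_mem_graft f hs, add_assoc]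
    · rw [forestWeight_cons, forestWeight_cons, forestWeight_of_mem_graftChildren F hH]
      omega

end

end PlanarTree

-- Root grafting, root deletion and leading terms for the arity.

namespace Br

noncomputable section

open PlanarTree

variable {K : Type*} [Field K] {D : Type*}

theorem mem_span_range_of (v : Br K D) : v ∈ Submodule.span K (Set.range (of K (D := D))) := by
  have h : linExt (of K (D := D)) = LinearMap.id := hom_ext fun t => by simp
  rw [← LinearMap.id_apply (R := K) v, ← h]
  rw [Finsupp.mem_span_range_iff_exists_finsupp]
  exact ⟨v, rfl⟩

theorem induction {p : Br K D → Prop} (v : Br K D) (hof : ∀ t, p (of K t)) (hzero : p 0)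
    (hadd : ∀ u v, p u → p v → p (u + v)) (hsmul : ∀ (k : K) v, p v → p (k • v)) : p v :=
  Submodule.span_induction (p := fun v _ => p v) (by rintro _ ⟨t, rfl⟩; exact hof t) hzero
    (fun u v _ _ => hadd u v) (fun k v _ => hsmul k v) (mem_span_range_of v)

variable (K) in
/-- The span of the trees with a given property. -/
def treeSpan (p : PlanarTree D → Prop) : Submodule K (Br K D) :=
  Submodule.span K (of K '' {t | p t})

theorem of_mem_treeSpan {p : PlanarTree D → Prop} {t : PlanarTree D} (h : p t) :
    of K t ∈ treeSpan K p :=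
  Submodule.subset_span ⟨t, h, rfl⟩

theorem treeSpan_le {p : PlanarTree D → Prop} {N : Submodule K (Br K D)}
    (h : ∀ t, p t → of K t ∈ N) : treeSpan K p ≤ N := by
  refine Submodule.span_le.mpr ?_
  rintro _ ⟨t, ht, rfl⟩
  exact h t ht

theorem treeSpan_mono {p q : PlanarTree D → Prop} (h : ∀ t, p t → q t) :
    treeSpan K p ≤ treeSpan K q :=
  treeSpan_le fun t ht => of_mem_treeSpan (h t ht)

theorem lsum_mem_treeSpan {α : Type*} {p : PlanarTree D → Prop} (L : List α)
    (g : α → PlanarTree D) (h : ∀ a ∈ L, p (g a)) :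
    (lsum L fun a => of K (g a)) ∈ treeSpan K p := by
  induction L with
  | nil => exact Submodule.zero_mem _
  | cons a L ih =>
    rw [lsum_cons]
    exact Submodule.add_mem _ (of_mem_treeSpan (h a (by simp)))
      (ih fun b hb => h b (by simp [hb]))

/-- The graftings of `x` on the root of `y`. -/
def rootMul : Br K D →ₗ[K] Br K D →ₗ[K] Br K D :=
  linExt fun x => linExt fun t => match t with
    | node d F => lsum (inserts x F) fun G => of K (node d G)

theorem rootMul_of (x : PlanarTree D) (d : D) (F : List (PlanarTree D)) :
    rootMul (of K x) (of K (node d F)) = lsum (inserts x F) fun G => of K (node d G) := by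
  rw [rootMul, linExt_of, linExt_of]

/-- The operator which deletes the first child of the root, with the coefficient given by a
linear form. -/
def rootDel (l : Br K D →ₗ[K] K) : Br K D →ₗ[K] Br K D :=
  linExt fun t => match t with
    | node _ [] => 0
    | node d (x :: F) => l (of K x) • of K (node d F)

theorem rootDel_of_nil (l : Br K D →ₗ[K] K) (d : D) : rootDel l (of K (node d [])) = 0 := by
  rw [rootDel, linExt_of]

theorem rootDel_of_cons (l : Br K D →ₗ[K] K) (d : D) (x : PlanarTree D) (F : List (PlanarTree D)) :
    rootDel l (of K (node d (x :: F))) = l (of K x) • of K (node d F) := by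
  rw [rootDel, linExt_of]

theorem rootMul_comm (x y z : Br K D) :
    rootMul x (rootMul y z) = rootMul y (rootMul x z) := by
  induction x using induction with
  | hof x =>
    induction y using induction with
    | hof y =>
      induction z using induction with
      | hof t =>
        obtain ⟨d, F⟩ := t
        simp only [rootMul_of, map_lsum]
        exact lsum_inserts_comm x y F fun G => of K (node d G)
      | hzero => simp
      | hadd u v hu hv => simp only [map_add, hu, hv]
      | hsmul k v hv => simp only [map_smul, hv]
    | hzero => simp
    | hadd u v hu hv => simp only [map_add, LinearMap.add_apply, hu, hv]
    | hsmul k v hv => simp only [map_smul, LinearMap.smul_apply, hv]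
  | hzero => simp
  | hadd u v hu hv => simp only [map_add, LinearMap.add_apply, hu, hv]
  | hsmul k v hv => simp only [map_smul, LinearMap.smul_apply, hv]

/-- After an insertion of `x`, the first child is either `x`, whose deletion gives back `y` with
coefficient `l x`, or the old first child, with `x` inserted behind it. -/
theorem rootDel_rootMul (l : Br K D →ₗ[K] K) (x y : Br K D) :
    rootDel l (rootMul x y) = rootMul x (rootDel l y) + l x • y := by
  induction x using induction with
  | hof x =>
    induction y using induction with
    | hof t =>
      obtain ⟨d, _ | ⟨f, F⟩⟩ := t
      · simp [rootMul_of, inserts, rootDel_of_nil, rootDel_of_cons]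
      · simp only [rootMul_of, inserts, lsum_cons, lsum_map, map_add, map_lsum, rootDel_of_cons,
          map_smul]
        rw [add_comm]
        congr 1
        exact (map_lsum (l (of K f) • LinearMap.id (R := K) (M := Br K D)) _ _).symm
    | hzero => simp
    | hadd u v hu hv => simp only [map_add, smul_add, hu, hv]; abel
    | hsmul k v hv => simp only [map_smul, hv, smul_add, smul_comm k]
  | hzero => simp
  | hadd u v hu hv => simp only [map_add, LinearMap.add_apply, hu, hv, add_smul]; abel
  | hsmul k v hv =>
    simp only [map_smul, LinearMap.smul_apply, hv, smul_add, smul_eq_mul, mul_smul]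

/-- Each application removes a child, so a tree with `k` children is killed after `k + 1` of them.
-/
theorem exists_rootDel_pow_eq_zero (l : Br K D →ₗ[K] K) (x : Br K D) :
    ∃ r, ((rootDel l : Module.End K (Br K D)) ^ r) x = 0 := by
  have hle : ∀ (r s : ℕ) (x : Br K D), ((rootDel l : Module.End K (Br K D)) ^ r) x = 0 →
      ((rootDel l : Module.End K (Br K D)) ^ (s + r)) x = 0 := by
    intro r s x h
    rw [pow_add, Module.End.mul_apply, h, map_zero]
  induction x using induction with
  | hof t =>
    obtain ⟨d, F⟩ := t
    induction F with
    | nil => exact ⟨1, by rw [pow_one, rootDel_of_nil]⟩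
    | cons x F ih =>
      obtain ⟨r, hr⟩ := ih
      exact ⟨r + 1, by rw [pow_succ, Module.End.mul_apply, rootDel_of_cons, map_smul, hr,
        smul_zero]⟩
  | hzero => exact ⟨0, map_zero _⟩
  | hadd u v hu hv =>
    obtain ⟨r, hr⟩ := hu
    obtain ⟨s, hs⟩ := hv
    refine ⟨r + s, ?_⟩
    rw [map_add, hle s r v hs, add_comm r s, hle r s u hr, add_zero]
  | hsmul k v hv =>
    obtain ⟨r, hr⟩ := hv
    exact ⟨r, by rw [map_smul, hr, smul_zero]⟩

theorem rootMul_of_mem (x t : PlanarTree D) : rootMul (of K x) (of K t) ∈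
    treeSpan K fun s => weight s = weight x + weight t ∧ arity s = arity t + 1 := by
  obtain ⟨d, F⟩ := t
  rw [rootMul_of]
  refine lsum_mem_treeSpan _ _ fun G hG => ?_
  have h := perm_of_mem_inserts hG
  rw [weight_node, weight_node, h.forestWeight_eq, forestWeight_cons, add_assoc]
  exact ⟨rfl, h.length_eq⟩

theorem mul_sub_rootMul_of_mem (x t : PlanarTree D) :
    of K x * of K t - rootMul (of K x) (of K t) ∈
      treeSpan K fun s => weight s = weight x + weight t ∧ arity s = arity t := by
  obtain ⟨d, F⟩ := t
  have h : of K x * of K (node d F) = lsum (graftForest [x] F) fun G => of K (node d G) := by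
    rw [← lsum_graft_node]
    exact brace_of [x] (node d F)
  rw [h, rootMul_of, lsum_graftForest_singleton, add_sub_cancel_left]
  refine lsum_mem_treeSpan _ _ fun G hG => ?_
  rw [weight_node, weight_node, forestWeight_of_mem_graftChildren F hG, add_assoc]
  exact ⟨rfl, length_of_mem_graftChildren hG⟩

/-- As `x` need not be homogeneous in weight, only the arity is controlled here. -/
theorem rootMul_mem {p q : PlanarTree D → Prop} (h : ∀ s t, p t → arity s = arity t + 1 → q s)
    (x : Br K D) {y : Br K D} (hy : y ∈ treeSpan K p) : rootMul x y ∈ treeSpan K q := by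
  induction x using induction with
  | hof x =>
    refine (treeSpan_le (N := (treeSpan K q).comap (rootMul (of K x))) fun t ht => ?_) hy
    exact treeSpan_mono (fun s hs => h s t ht hs.2) (rootMul_of_mem x t)
  | hzero => rw [map_zero]; exact Submodule.zero_mem _
  | hadd u v hu hv => rw [map_add]; exact Submodule.add_mem _ hu hv
  | hsmul k v hv => rw [map_smul]; exact Submodule.smul_mem _ _ hv

theorem mul_sub_rootMul_mem {p q : PlanarTree D → Prop} (h : ∀ s t, p t → arity s = arity t → q s)
    (x : Br K D) {y : Br K D} (hy : y ∈ treeSpan K p) : x * y - rootMul x y ∈ treeSpan K q := by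
  induction x using induction with
  | hof x =>
    refine (treeSpan_le (N := (treeSpan K q).comap
      (LinearMap.mulLeft K (of K x) - rootMul (of K x))) fun t ht => ?_) hy
    exact treeSpan_mono (fun s hs => h s t ht hs.2) (mul_sub_rootMul_of_mem x t)
  | hzero => rw [zero_mul, map_zero, LinearMap.zero_apply, sub_zero]; exact Submodule.zero_mem _
  | hadd u v hu hv =>
    rw [map_add, add_mul, LinearMap.add_apply, add_sub_add_comm]
    exact Submodule.add_mem _ hu hv
  | hsmul k v hv =>
    rw [map_smul, smul_mul_assoc, LinearMap.smul_apply, ← smul_sub]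
    exact Submodule.smul_mem _ _ hv

theorem foldr_rootMul_mem (l : List (Br K D)) (t : PlanarTree D) :
    l.foldr (fun x y => rootMul x y) (of K t) ∈ treeSpan K fun s => arity s = arity t + l.length := by
  induction l with
  | nil => exact of_mem_treeSpan rfl
  | cons x l ih =>
    exact rootMul_mem (fun s t h h' => by rw [List.length_cons]; omega) x ih

/-- The leading term of an iterated pre-Lie product is the iterated root grafting: each factor
raises the top arity by one, and its correction term does not. -/
theorem foldr_mul_sub_foldr_rootMul_mem (l : List (Br K D)) (t : PlanarTree D) :
    l.foldr (· * ·) (of K t) - l.foldr (fun x y => rootMul x y) (of K t) ∈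
      treeSpan K fun s => arity s < arity t + l.length := by
  induction l with
  | nil => simp
  | cons x l ih =>
    simp only [List.foldr_cons, List.length_cons]
    set z := l.foldr (· * ·) (of K t)
    set u := l.foldr (fun x y => rootMul x y) (of K t) with hu
    have hz : z ∈ treeSpan K fun s => arity s < arity t + l.length + 1 := by
      have h := Submodule.add_mem _
        (treeSpan_mono (q := fun s => arity s < arity t + l.length + 1)
          (fun s hs => by omega) ih)
        (treeSpan_mono (q := fun s => arity s < arity t + l.length + 1)
          (fun s hs => by omega) (foldr_rootMul_mem (K := K) l t))
      rwa [sub_add_cancel] at h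
    have e : x * z - rootMul x u = (x * z - rootMul x z) + rootMul x (z - u) := by
      rw [map_sub, sub_add_sub_cancel]
    rw [e, ← add_assoc]
    exact Submodule.add_mem _ (mul_sub_rootMul_mem (fun s t h h' => by omega) x hz)
      (rootMul_mem (fun s t h h' => by omega) x ih)

open Classical in
/-- The projection on the span of the trees with a given property. -/
def treeProj (p : PlanarTree D → Prop) : Br K D →ₗ[K] Br K D :=
  linExt fun t => if p t then of K t else 0

theorem treeProj_eq_self {p : PlanarTree D → Prop} {v : Br K D} (h : v ∈ treeSpan K p) :
    treeProj p v = v := by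
  refine (treeSpan_le (N := LinearMap.eqLocus (treeProj p) LinearMap.id) fun t ht => ?_) h
  rw [LinearMap.mem_eqLocus, treeProj, linExt_of, if_pos ht, LinearMap.id_apply]

theorem treeProj_eq_zero {p q : PlanarTree D → Prop} (hpq : ∀ t, q t → ¬ p t) {v : Br K D}
    (h : v ∈ treeSpan K q) : treeProj p v = 0 := by
  refine (treeSpan_le (N := LinearMap.ker (treeProj p)) fun t ht => ?_) h
  rw [LinearMap.mem_ker, treeProj, linExt_of, if_neg (hpq t ht)]

/-- A family whose leading terms with respect to the arity are independent is independent. -/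
theorem linearIndependent_of_leading {ι : Type*} {u e : ι → Br K D} (N : ι → ℕ)
    (hu : ∀ i, u i ∈ treeSpan K fun s => arity s = N i)
    (he : ∀ i, e i - u i ∈ treeSpan K fun s => arity s < N i)
    (hind : LinearIndependent K u) : LinearIndependent K e := by
  classical
  refine linearIndependent_iff.mpr fun F hF => ?_
  by_contra hne
  obtain ⟨i₀, hi₀, hmax⟩ := F.support.exists_max_image N (Finsupp.support_nonempty_iff.mpr hne)
  -- In a relation, projecting to the largest arity `N i₀` that occurs kills all remainders and all
  -- lower leading terms; what is left is a relation between the `u i`.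
  have hproj : ∀ i ∈ F.support,
      treeProj (fun s => arity s = N i₀) (e i) = if N i = N i₀ then u i else 0 := by
    intro i hi
    have hlow : treeProj (fun s => arity s = N i₀) (e i - u i) = 0 :=
      treeProj_eq_zero (fun t ht => by have := hmax i hi; omega) (he i)
    rw [map_sub, sub_eq_zero] at hlow
    rw [hlow]
    split_ifs with h
    · exact treeProj_eq_self (h ▸ hu i)
    · exact treeProj_eq_zero (fun t ht => by omega) (hu i)
  have h0 : Finsupp.linearCombination K u (F.filter fun i => N i = N i₀) = 0 := by
    rw [Finsupp.linearCombination_apply, Finsupp.sum, Finsupp.support_filter, Finset.sum_filter]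
    have h := congrArg (treeProj fun s => arity s = N i₀) hF
    rw [Finsupp.linearCombination_apply, Finsupp.sum, map_sum, map_zero] at h
    refine Eq.trans ?_ h
    refine Finset.sum_congr rfl fun i hi => ?_
    rw [map_smul, hproj i hi]
    split_ifs with hN
    · rw [Finsupp.filter_apply_pos (fun i => N i = N i₀) F hN]
    · rw [smul_zero]
  have h1 := DFunLike.congr_fun (linearIndependent_iff.mp hind _ h0) i₀
  rw [Finsupp.filter_apply_pos (fun i => N i = N i₀) F rfl] at h1
  exact Finsupp.mem_support_iff.mp hi₀ h1

variable (K D) in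
/-- The span of the graftings on the root. -/
def rootIdeal : Submodule K (Br K D) :=
  Submodule.span K {v | ∃ x y, v = rootMul x y}

/-- The monomials in independent elements, applied to a family independent modulo the graftings on
the root, are independent. -/
theorem linearIndependent_rootMul [CharZero K] {I J : Type*} {v : I → Br K D}
    (hv : LinearIndependent K v) {c : J → Br K D}
    (hc : LinearIndependent K fun j => (rootIdeal K D).mkQ (c j))
    [LeftCommutative fun i (y : Br K D) => rootMul (v i) y] :
    LinearIndependent K fun p : Multiset I × J => p.1.foldr (fun i y => rootMul (v i) y) (c p.2) := by
  classical
  -- The coordinates on the span of `v` are extended to the whole space, giving forms `l i` dual to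
  -- the `v j`.
  obtain ⟨g, hg⟩ := LinearMap.exists_extend hv.repr
  have hgv : ∀ i, g (v i) = Finsupp.single i 1 := fun i => by
    have h := LinearMap.congr_fun hg ⟨v i, Submodule.subset_span ⟨i, rfl⟩⟩
    exact h.trans (hv.repr_eq_single i _ rfl)
  let l : I → Br K D →ₗ[K] K := fun i => Finsupp.lapply i ∘ₗ g
  have hl : ∀ i j, l i (v j) = Finsupp.single j 1 i := fun i j => by
    change g (v j) i = _
    rw [hgv]
  let A : I → Module.End K (Br K D) := fun i => rootMul (v i)
  refine linearIndependent_monomials (A := A) (B := fun i => rootDel (l i))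
    (fun i j => LinearMap.ext fun x => rootMul_comm _ _ x) (fun i j x hij => ?_)
    (fun i x => ?_) (fun i x => exists_rootDel_pow_eq_zero _ x) ?_
  · change rootDel (l i) (rootMul (v j) x) = _
    rw [rootDel_rootMul, hl, Finsupp.single_eq_of_ne hij, zero_smul, add_zero]
  · change rootDel (l i) (rootMul (v i) x) = _
    rw [rootDel_rootMul, hl, Finsupp.single_eq_same, one_smul]
  -- The ranges lie inside `rootIdeal`, so independence modulo `rootIdeal` is the stronger
  -- condition.
  · have hle : sumRange A Set.univ ≤ rootIdeal K D :=
      sumRange_le fun i _ x => Submodule.subset_span ⟨v i, x, rfl⟩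
    exact LinearIndependent.of_comp (Submodule.factor hle) hc

end

end Br

-- Independence of the values of sorted trees, and generation.

namespace Br

noncomputable section

open PlanarTree

variable {K : Type*} [Field K] {D : Type*}

section Independence

variable [CharZero K] {S : Type*} [LinearOrder (PlanarTree S)] {τ : S → PlanarTree D}

/-- Induction on the weight: the children of a sorted tree with at most `n + 1` vertices have at
most `n`, so their values are independent by induction and the monomials in their root graftings are
independent. These monomials are the leading terms. -/
theorem linearIndepOn_combEval
    (hτ : LinearIndependent K fun s => (rootIdeal K D).mkQ (of K (τ s))) (n : ℕ) :
    LinearIndepOn K (combEval fun s => of K (τ s)) {t | IsSorted t ∧ weight t ≤ n} := by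
  induction n with
  | zero =>
    have : IsEmpty {t : PlanarTree S | IsSorted t ∧ weight t ≤ 0} :=
      ⟨fun t => absurd t.2.2 (Nat.not_le.mpr (weight_pos t.1))⟩
    exact linearIndependent_empty_type
  | succ n ih =>
    set f : S → Br K D := fun s => of K (τ s) with hf
    let I := {t : PlanarTree S | IsSorted t ∧ weight t ≤ n}
    let v : I → Br K D := fun t => combEval f t.1
    have hlc : LeftCommutative fun (i : I) (y : Br K D) => rootMul (v i) y :=
      ⟨fun i j y => rootMul_comm (v i) (v j) y⟩
    have hsub : ∀ (s : S) (F : List (PlanarTree S)), IsSorted (node s F) ∧ weight (node s F) ≤ n + 1 →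
        F.Pairwise (· ≤ ·) ∧ ∀ t ∈ F, t ∈ I := by
      rintro s F ⟨⟨_, _, h1, h2⟩, h3⟩
      refine ⟨h1, fun t ht => ⟨h2 t ht, ?_⟩⟩
      have := weight_le_forestWeight ht
      rw [weight_node] at h3
      omega
    -- The exponent of the leading monomial: the multiset of children, with the label of the root.
    -- It determines the tree, because a sorted list is determined by its multiset.
    let κ : {t : PlanarTree S | IsSorted t ∧ weight t ≤ n + 1} → Multiset I × S := fun t =>
      match t with
      | ⟨node s F, h⟩ => (↑(F.pmap (fun t ht => (⟨t, ht⟩ : I)) (hsub s F h).2), s)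
    have hκ : Function.Injective κ := by
      rintro ⟨⟨s, F⟩, h⟩ ⟨⟨s', F'⟩, h'⟩ e
      obtain ⟨e1, rfl⟩ := Prod.ext_iff.mp e
      have hp := (Multiset.coe_eq_coe.mp e1).map Subtype.val
      rw [List.map_pmap, List.map_pmap, List.pmap_eq_map, List.pmap_eq_map, List.map_id',
        List.map_id'] at hp
      obtain rfl := hp.eq_of_pairwise' (hsub _ F h).1 (hsub _ F' h').1
      rfl
    have hfold : ∀ s F h, (κ ⟨node s F, h⟩).1.foldr (fun i y => rootMul (v i) y) (f s) =
        (F.map (combEval f)).foldr (fun x y => rootMul x y) (f s) ∧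
        (κ ⟨node s F, h⟩).1.card = F.length := by
      intro s F h
      have e : (F.pmap (fun t ht => (⟨t, ht⟩ : I)) (hsub s F h).2).map v = F.map (combEval f) := by
        rw [List.map_pmap, List.pmap_eq_map]
      constructor
      · rw [← e, List.foldr_map]
        exact Multiset.coe_foldr _ _ _
      · exact (Multiset.coe_card _).trans List.length_pmap
    refine linearIndependent_of_leading
      (u := fun t => (κ t).1.foldr (fun i y => rootMul (v i) y) (f (κ t).2))
      (fun t => arity (τ (κ t).2) + (κ t).1.card) ?_ ?_
      ((linearIndependent_rootMul ih hτ).comp κ hκ)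
    · rintro ⟨⟨s, F⟩, h⟩
      rw [(hfold s F h).2, ← List.length_map (f := combEval f)]
      change (κ ⟨node s F, h⟩).1.foldr (fun i y => rootMul (v i) y) (f s) ∈ _
      rw [(hfold s F h).1]
      exact foldr_rootMul_mem _ _
    · rintro ⟨⟨s, F⟩, h⟩
      rw [(hfold s F h).2, ← List.length_map (f := combEval f)]
      change combEval f (node s F) - (κ ⟨node s F, h⟩).1.foldr (fun i y => rootMul (v i) y) (f s) ∈ _
      rw [(hfold s F h).1, combEval_node]
      exact foldr_mul_sub_foldr_rootMul_mem _ _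

theorem linearIndependent_combEval
    (hτ : LinearIndependent K fun s => (rootIdeal K D).mkQ (of K (τ s))) :
    LinearIndependent K fun t : {t : PlanarTree S // IsSorted t} =>
      combEval (fun s => of K (τ s)) t.1 := by
  have h : {t : PlanarTree S | IsSorted t} = ⋃ n, {t | IsSorted t ∧ weight t ≤ n} := by
    ext t
    simp only [Set.mem_iUnion, Set.mem_ofPred_eq]
    exact ⟨fun ht => ⟨_, ht, le_rfl⟩, fun ⟨_, ht, _⟩ => ht⟩
  have hmono : Monotone fun n : ℕ => {t : PlanarTree S | IsSorted t ∧ weight t ≤ n} :=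
    fun m n hmn t ht => ⟨ht.1, ht.2.trans hmn⟩
  have h' := linearIndepOn_iUnion_of_directed hmono.directed_le (linearIndepOn_combEval hτ)
  rw [← h] at h'
  exact h'

end Independence

/-- Root graftings of trees are homogeneous in weight and arity, so each homogeneous component of an
element of `rootIdeal` is a combination of root graftings of trees of matching degrees. -/
theorem treeProj_rootIdeal_mem {R : Submodule K (Br K D)} {n k : ℕ}
    (hR : ∀ x t : PlanarTree D, weight x + weight t = n → arity t + 1 = k →
      rootMul (of K x) (of K t) ∈ R) {v : Br K D} (hv : v ∈ rootIdeal K D) :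
    treeProj (fun s => weight s = n ∧ arity s = k) v ∈ R := by
  refine (Submodule.span_le (p := R.comap (treeProj fun s => weight s = n ∧ arity s = k))).mpr ?_ hv
  rintro _ ⟨x, y, rfl⟩
  rw [SetLike.mem_coe, Submodule.mem_comap]
  induction x using induction with
  | hof x =>
    induction y using induction with
    | hof t =>
      have h := rootMul_of_mem (K := K) x t
      by_cases hn : weight x + weight t = n ∧ arity t + 1 = k
      · rw [← hn.1, ← hn.2, treeProj_eq_self h]
        exact hR x t hn.1 hn.2
      · rw [treeProj_eq_zero (fun s hs hs' => hn ⟨hs.1.symm.trans hs'.1, hs.2.symm.trans hs'.2⟩) h]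
        exact Submodule.zero_mem _
    | hzero => simp only [map_zero]; exact Submodule.zero_mem _
    | hadd u v hu hv => simp only [map_add]; exact Submodule.add_mem _ hu hv
    | hsmul k v hv => simp only [map_smul]; exact Submodule.smul_mem _ _ hv
  | hzero => simp only [map_zero, LinearMap.zero_apply]; exact Submodule.zero_mem _
  | hadd u v hu hv => simp only [map_add, LinearMap.add_apply]; exact Submodule.add_mem _ hu hv
  | hsmul k v hv => simp only [map_smul, LinearMap.smul_apply]; exact Submodule.smul_mem _ _ hv

/-- Trees which span a complement of the graftings on the root generate the pre-Lie algebra. -/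
theorem mem_of_mul_mem {S : Type*} {τ : S → PlanarTree D}
    (hτ : Submodule.span K (Set.range fun s => of K (τ s)) ⊔ rootIdeal K D = ⊤)
    {R : Submodule K (Br K D)} (hmul : ∀ x ∈ R, ∀ y ∈ R, x * y ∈ R)
    (hR : ∀ s, of K (τ s) ∈ R) (v : Br K D) : v ∈ R := by
  -- Induction on the weight, then on the arity. The tree is decomposed along `hτ`, and both parts
  -- are projected to its weight and arity.
  have key : ∀ n k (t : PlanarTree D), weight t = n → arity t = k → of K t ∈ R := by
    intro n
    induction n using Nat.strong_induction_on with
    | _ n ihn =>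
      intro k
      induction k using Nat.strong_induction_on with
      | _ k ihk =>
        intro t hn hk
        obtain ⟨a, ha, b, hb, hab⟩ := Submodule.mem_sup.mp
          (hτ ▸ Submodule.mem_top : of K t ∈ Submodule.span K (Set.range fun s => of K (τ s)) ⊔ rootIdeal K D)
        rw [← treeProj_eq_self (p := fun s => weight s = n ∧ arity s = k)
          (of_mem_treeSpan (K := K) ⟨hn, hk⟩), ← hab, map_add]
        refine Submodule.add_mem _ ?_ (treeProj_rootIdeal_mem (fun x u hxu hu => ?_) hb)
        · refine (Submodule.span_le
            (p := R.comap (treeProj fun s => weight s = n ∧ arity s = k))).mpr ?_ ha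
          rintro _ ⟨s, rfl⟩
          rw [SetLike.mem_coe, Submodule.mem_comap, treeProj, linExt_of]
          split_ifs
          · exact hR s
          · exact Submodule.zero_mem _
        -- Both factors have fewer than `n` vertices, so their pre-Lie product is in `R`. It differs
        -- from the root grafting by trees of weight `n` and arity `arity u < k`, also in `R`.
        · have hx := weight_pos x
          have hu' := weight_pos u
          have h1 := hmul _ (ihn (weight x) (by omega) _ x rfl rfl)
            _ (ihn (weight u) (by omega) _ u rfl rfl)
          have h2 : treeSpan K (fun s => weight s = weight x + weight u ∧ arity s = arity u) ≤ R :=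
            treeSpan_le fun s hs => ihk (arity u) (by omega) s (hs.1.trans hxu) hs.2
          have h3 := Submodule.sub_mem _ h1 (h2 (mul_sub_rootMul_of_mem x u))
          rwa [sub_sub_cancel] at h3
  exact Submodule.span_le.mpr (by rintro _ ⟨t, rfl⟩; exact key _ _ t rfl rfl) (mem_span_range_of v)

end

end Br

theorem mainTheorem3 (K : Type*) [Field K] [CharZero K] (D : Type*) :
    IsFreePreLie K (Br K D) := by
  -- Among the classes of all trees modulo `rootIdeal`, a basis of the quotient is extracted.
  obtain ⟨ι, a, -, hspan, hind⟩ :=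
    exists_linearIndependent' K fun t : PlanarTree D => (Br.rootIdeal K D).mkQ (Br.of K t)
  refine ⟨Set.range fun i => Br.of K (a i), ?_⟩
  set S : Set (Br K D) := Set.range fun i => Br.of K (a i)
  choose κ hκ using fun s : S => s.2
  have hf : (fun s : S => (s : Br K D)) = fun s => Br.of K (a (κ s)) :=
    funext fun s => (hκ s).symm
  have hκ' : Function.Injective κ := fun s t h => Subtype.ext (by rw [← hκ s, ← hκ t, h])
  let φ : FreePreLie K S →ₙₐ[K] Br K D := FreePreLie.lift K fun s : S => (s : Br K D)
  constructor
  -- Any linear order will do: it only selects a planar representative of each rooted tree.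
  · obtain ⟨_, _⟩ := exists_wellFoundedLT (α := PlanarTree S)
    rw [hf]
    exact FreePreLie.lift_injective_of_linearIndependent _
      (Br.linearIndependent_combEval (τ := fun s => a (κ s)) (hind.comp κ hκ'))
  · intro v
    refine Br.mem_of_mul_mem (K := K) (τ := a)
      (R := LinearMap.range (φ : FreePreLie K S →ₗ[K] Br K D)) ?_ ?_ (fun i => ?_) v
    -- Pulling `hspan` back along the quotient map turns spanning of the quotient into the required
    -- sum with `rootIdeal`.
    · have h := congrArg (Submodule.comap (Br.rootIdeal K D).mkQ) hspan
      have h' : Submodule.span K (Set.range (Br.of K (D := D))) = ⊤ :=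
        eq_top_iff.mpr fun v _ => Br.mem_span_range_of v
      have e : ∀ {α : Type _} (g : α → Br K D),
          Submodule.span K (Set.range fun i => (Br.rootIdeal K D).mkQ (g i)) =
            (Submodule.span K (Set.range g)).map (Br.rootIdeal K D).mkQ := fun g => by
        rw [Submodule.map_span, ← Set.range_comp]; rfl
      rw [e (Br.of K), h', Submodule.map_top, Submodule.range_mkQ, Submodule.comap_top] at h
      rw [← h, sup_comm, ← Submodule.comap_map_mkQ, ← e]
      rfl
    · rintro _ ⟨x, rfl⟩ _ ⟨y, rfl⟩
      exact ⟨x * y, map_mul φ x y⟩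
    · exact ⟨FreePreLie.of K ⟨_, i, rfl⟩, FreeNonUnitalNonAssocAlgebra.lift_of_apply K _ _⟩
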